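/- Let $\mathbb G$ be a homogeneous Lie group, i.e. $\mathbb R^N$ ($N\ge 1$) with a smooth group law for which the dilations $D_r(x)=(r^{w_1}x_1,\dots,r^{w_N}x_N)$, $r>0$ (with fixed $w_i>0$), are automorphisms. Let $Q=w_1+\dots+w_N$, let $dx$ and $|A|$ denote Lebesgue (= Haar) measure, and let $|\cdot|$ be a quasi-norm: a continuous function $\mathbb G\to[0,\infty)$ with $|x^{-1}|=|x|$, $|D_r x|=r|x|$ for $r>0$, and $|x|=0\iff x=0$. Put $\mathbb B(0,r)=\{y:|y|<r\}$ and $\mathfrak S=\{|x|=1\}$, let $\sigma$ be the measure on $\mathfrak S$ with $\int_{\mathbb G} f\,dx=\int_0^\infty\int_{\mathfrak S} f(D_r\omega)\,r^{Q-1}\,d\sigma(\omega)\,dr$, and $|\mathfrak S|=\sigma(\mathfrak S)$. For $s\ne 0$ and $t\in\mathbb R$ let $s^{t}:=D_{|s|^{t-1}}s$ (that is, $s=D_r\omega\mapsto D_{r^{t}}\omega$ in polar coordinates). Let $0<p\le q<\infty$, $\epsilon>0$, let $u,v:\mathbb G\to[0,\infty)$ be measurable weights, and set $$\tilde u(s)=u(s^{-1/\epsilon})\,\tfrac1\epsilon|s|^{-Q(1+1/\epsilon)},\qquad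 \tilde v(s)=v(s^{-1/\epsilon})\,\tfrac1\epsilon|s|^{-Q(1+1/\epsilon)},\qquad \tilde u_1(x)=\frac1{|\mathfrak S|}\int_{\mathfrak S}\tilde u(D_{|x|}\omega)\,d\sigma(\omega),$$ $$\tilde D_Q=\sup_{x\neq 0}\,|\mathbb B(0,|x|)|^{\frac1q-\frac1p}\,\tilde u_1(x)^{\frac1q}\left[\exp\left(\frac1{|\mathbb B(0,|x|)|}\int_{\mathbb B(0,|x|)}\log\frac1{\tilde v(y)}\,dy\right)\right]^{\frac1p}.$$ Suppose $\tilde D_Q<\infty$. Then there is a constant $0<C<\infty$ such that for all positive measurable functions $f$ on $\mathbb G$ $$\left(\int_{\mathbb G}\left[\exp\left(\epsilon\,|\mathbb B(0,|x|)|^{\epsilon}\int_{\mathbb G\setminus\mathbb B(0,|x|)}|\mathbb B(0,|y|)|^{-\epsilon-1}\log f(y)\,dy\right)\right]^q u(x)\,dx\right)^{\frac1q}\le C\left(\int_{\mathbb G} f^p(x)\,v(x)\,dx\right)^{\frac1p}.\tag{1}$$ Moreover, the optimal constant $C_{\mathrm{opt}}$ in (1), i.e. the infimum of all $C>0$ for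 which (1) holds for all such $f$, satisfies $$C_{\mathrm{opt}}\le\left(\frac pq\right)^{\frac1q}e^{\frac1p}\,\tilde D_Q ,$$ and $C_{\mathrm{opt}}>0$ if in addition $u>0$ almost everywhere and $\tilde D_Q>0$. Here the integrals of logarithms are taken in $[-\infty,\infty]$ with $\log 0=-\infty$, $\log\frac10=+\infty$, $\exp(-\infty)=0$, $\exp(+\infty)=+\infty$; an integral whose positive and negative parts are both infinite is given the value $+\infty$; and $0\cdot\infty=0$. -/

import Mathlib

open MeasureTheory
open scoped NNReal ENNReal

noncomputable section

/-- The anisotropic dilation `D_r x = (r ^ w₁ x₁, …, r ^ w_N x_N)` of `ℝ^N`. -/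
def anisotropicDilation {N : ℕ} (w : Fin N → ℝ) (r : ℝ) (x : Fin N → ℝ) : Fin N → ℝ :=
  fun i => r ^ w i * x i

/-- A homogeneous (Lie) group: `ℝ^N` with a smooth group law such that, for some exponents
`w₁, …, w_N > 0`, every dilation `D_r`, `r > 0`, is an automorphism of the group. (The identity
is then automatically the origin, and Haar measure is the Lebesgue measure `volume`.) -/
structure HomogeneousGroup (N : ℕ) where
  /-- the group law -/
  group : Group (Fin N → ℝ)
  contDiff_mul : ContDiff ℝ ((⊤ : ℕ∞) : WithTop ℕ∞)
    (fun z : (Fin N → ℝ) × (Fin N → ℝ) => group.mul z.1 z.2)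
  contDiff_inv : ContDiff ℝ ((⊤ : ℕ∞) : WithTop ℕ∞) (fun x : Fin N → ℝ => group.inv x)
  /-- the dilation exponents -/
  exponent : Fin N → ℝ
  exponent_pos : ∀ i, 0 < exponent i
  dilation_mul : ∀ r : ℝ, 0 < r → ∀ x y : Fin N → ℝ,
    anisotropicDilation exponent r (group.mul x y) =
      group.mul (anisotropicDilation exponent r x) (anisotropicDilation exponent r y)

namespace HomogeneousGroup

variable {N : ℕ} (G : HomogeneousGroup N)

/-- The dilation `D_r` of the homogeneous group. -/
def dil (r : ℝ) (x : Fin N → ℝ) : Fin N → ℝ := anisotropicDilation G.exponent r x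

/-- The homogeneous dimension `Q`. -/
def homDim : ℝ := ∑ i, G.exponent i

end HomogeneousGroup

/-- A quasi-norm on a homogeneous group. -/
structure QuasiNorm {N : ℕ} (G : HomogeneousGroup N) where
  toFun : (Fin N → ℝ) → ℝ
  continuous_toFun : Continuous toFun
  nonneg : ∀ x, 0 ≤ toFun x
  map_inv : ∀ x, toFun (G.group.inv x) = toFun x
  map_dil : ∀ (r : ℝ) (x : Fin N → ℝ), 0 < r → toFun (G.dil r x) = r * toFun x
  eq_zero_iff : ∀ x, toFun x = 0 ↔ x = 0

/-- The integral of an extended-real function: the integral of its positive part minus the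
integral of its negative part. If both are infinite (so that the integral does not exist) the
value is `+∞`. Thus the finiteness of a quantity built from such an integral includes
its existence. -/
def extIntegral {α : Type*} [MeasurableSpace α] (μ : Measure α) (g : α → EReal) : EReal :=
  -(((∫⁻ a, (-g a).toENNReal ∂μ : ℝ≥0∞) : EReal) - ((∫⁻ a, (g a).toENNReal ∂μ : ℝ≥0∞) : EReal))

namespace QuasiNorm

variable {N : ℕ} {G : HomogeneousGroup N} (ρ : QuasiNorm G)

/-- The quasi-ball `B(0, r)`. -/
def ball (r : ℝ) : Set (Fin N → ℝ) := {y | ρ.toFun y < r}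

/-- The volume `|B(0, |x|)|`. -/
def vol (x : Fin N → ℝ) : ℝ := (volume : Measure (Fin N → ℝ)).real (ρ.ball (ρ.toFun x))

/-- The radial projection `x ↦ D_{1/|x|} x` onto the unit quasi-sphere (for `x ≠ 0`). -/
def toSphere (x : Fin N → ℝ) : Fin N → ℝ := G.dil (ρ.toFun x)⁻¹ x

theorem measurable_toSphere : Measurable ρ.toSphere := by
  have h := ρ.continuous_toFun.measurable
  unfold toSphere HomogeneousGroup.dil anisotropicDilation
  refine measurable_pi_lambda _ fun i => ?_
  exact (h.inv.pow_const _).mul (measurable_pi_apply i)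

/-- The surface measure `σ` on the unit quasi-sphere `{|x| = 1}`, as a measure on `ℝ^N` carried
by that sphere: `σ A` is `Q` times the volume of `{x : 0 < |x| < 1, D_{1/|x|} x ∈ A}`. This is the
measure in the polar decomposition `∫ f dx = ∫_0^∞ ∫ f (D_r ω) r^(Q-1) dσ(ω) dr`. -/
def sphereMeasure : Measure (Fin N → ℝ) :=
  ENNReal.ofReal G.homDim • ((volume.restrict (ρ.ball 1)).map ρ.toSphere)

/-- The spherical average `U₁(x) = |𝔖|⁻¹ ∫ U(|x| ω) dσ(ω)`. -/
def sphereAvg (U : (Fin N → ℝ) → ℝ≥0∞) (x : Fin N → ℝ) : ℝ≥0∞ :=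
  (∫⁻ ω, U (G.dil (ρ.toFun x) ω) ∂ρ.sphereMeasure) / ρ.sphereMeasure Set.univ

/-- The radial power `s ^ t`: in polar coordinates `s = D_r ω`, with `r = |s|` and `|ω| = 1`,
it is `D_{r ^ t} ω` (for `s ≠ 0`). -/
def radialPow (t : ℝ) (s : Fin N → ℝ) : Fin N → ℝ := G.dil (ρ.toFun s ^ t) (ρ.toSphere s)

/-- The transformed weight `w̃(s) = w(s ^ (-1/ε)) ε⁻¹ |s| ^ (-Q (1 + 1/ε))`. -/
def tildeWeight (ε : ℝ) (w : (Fin N → ℝ) → ℝ≥0) (s : Fin N → ℝ) : ℝ≥0∞ :=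
  (w (ρ.radialPow (-(1 / ε)) s) : ℝ≥0∞) *
    ENNReal.ofReal (ε⁻¹ * ρ.toFun s ^ (-(G.homDim * (1 + 1 / ε))))

/-- The constant
`D_Q = sup_{x ≠ 0} |B(0,|x|)|^(1/q-1/p) U₁(x)^(1/q) exp(|B(0,|x|)|⁻¹ ∫_{B(0,|x|)} log(1/V))^(1/p)`
of a pair of weights `U`, `V`. -/
def weightConst (p q : ℝ) (U V : (Fin N → ℝ) → ℝ≥0∞) : ℝ≥0∞ :=
  ⨆ (x : Fin N → ℝ) (_ : x ≠ 0),
    ENNReal.ofReal (ρ.vol x ^ (1 / q - 1 / p)) * (ρ.sphereAvg U x) ^ (1 / q) *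
      (EReal.exp ((((ρ.vol x)⁻¹ : ℝ) : EReal) *
        extIntegral (volume.restrict (ρ.ball (ρ.toFun x)))
          (fun y => ENNReal.log (V y)⁻¹))) ^ (1 / p)

/-- The constant `D̃_Q`: the constant `D_Q` of the transformed weights `ũ`, `ṽ`. -/
def dualWeightConst (p q ε : ℝ) (u v : (Fin N → ℝ) → ℝ≥0) : ℝ≥0∞ :=
  ρ.weightConst p q (ρ.tildeWeight ε u) (ρ.tildeWeight ε v)

/-- The conjugate exponential operator
`exp (ε |B(0,|x|)|^ε ∫_{𝔾 \ B(0,|x|)} |B(0,|y|)|^(-ε-1) log f(y) dy)`. -/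
def dualExpMean (ε : ℝ) (f : (Fin N → ℝ) → ℝ) (x : Fin N → ℝ) : ℝ≥0∞ :=
  EReal.exp (((ε * ρ.vol x ^ ε : ℝ) : EReal) *
    extIntegral (volume.restrict (ρ.ball (ρ.toFun x))ᶜ)
      (fun y => ((ρ.vol y ^ (-ε - 1) * Real.log (f y) : ℝ) : EReal)))

/-- The weighted inequality for the conjugate exponential operator holds with constant `C` for
all positive measurable functions. -/
def DualInequality (p q ε : ℝ) (u v : (Fin N → ℝ) → ℝ≥0) (C : ℝ≥0) : Prop :=
  ∀ f : (Fin N → ℝ) → ℝ, Measurable f → (∀ x, 0 < f x) →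
    (∫⁻ x, (ρ.dualExpMean ε f x) ^ q * (u x : ℝ≥0∞)) ^ (1 / q) ≤
      (C : ℝ≥0∞) * (∫⁻ x, ENNReal.ofReal (f x ^ p) * (v x : ℝ≥0∞)) ^ (1 / p)

/-- The optimal constant: the infimum of the positive constants for which the inequality holds. -/
def dualBestConst (p q ε : ℝ) (u v : (Fin N → ℝ) → ℝ≥0) : ℝ≥0∞ :=
  ⨅ (C : ℝ≥0) (_ : 0 < C ∧ ρ.DualInequality p q ε u v C), (C : ℝ≥0∞)

end QuasiNorm

end

/-! The substitution `x = s ^ (-1/ε)` turns complements of quasi-balls into quasi-balls. Its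
Jacobian, multiplied by the kernel `|B(0,|y|)| ^ (-ε-1)`, is constant. The conjugate operator thus
becomes the geometric mean over `B(0,|s|)` of `g(z) = f(z ^ (-1/ε))`, and the weights `u`, `v`
become `ũ`, `ṽ` (`dualExpMean_radialPow`, `lintegral_mul_weight`). It remains to bound geometric
means over balls for a pair `U`, `V` with finite weight constant `D` (`lintegral_expMean_le`).

Write `m = |B(0,|s|)|`, `a = q/p`, `h = g ^ p V`. Jensen's inequality is applied to `h · vol`, not
to `h`. As the mean of `log vol` over the ball is `log m - 1`, the `p`-th power of the geometric
mean of `g` is at most the geometric mean of `1/V` times `(e/m²) ∫_B h vol` (`expMean_rpow_le`).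
Take the power `a`, move it inside the integral by Hölder, and absorb the mean of `1/V` and the
spherical average of `U` into `D`. What remains is `m ^ (-a-1) ∫_B h vol ^ a`, whose integral over
`s` is exactly `(1/a) ∫ h` by Tonelli (`lintegral_hardy`). The factors `1/a` and `e ^ a` yield
`(p/q) ^ (1/q) e ^ (1/p)`. Replacing `U` by its spherical average costs nothing because the
geometric mean is radial (`lintegral_mul_sphereAvg`). All radial computations use the volume of the
ball as radial coordinate, which is distributed as Lebesgue measure on `(0,∞)` (`map_vol_toSphere`).

For positivity, a positive finite weight constant makes `log⁺ ṽ` integrable on some ball. This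
allows a test function with finite right side and nonzero left side, so every admissible constant is
at least their quotient. -/

namespace HomogeneousGroup

variable {N : ℕ} (G : HomogeneousGroup N)

/-! ### Dilations and Lebesgue measure -/

theorem dil_apply (r : ℝ) (x : Fin N → ℝ) (i : Fin N) : G.dil r x i = r ^ G.exponent i * x i := rfl

theorem dil_one (x : Fin N → ℝ) : G.dil 1 x = x := by
  ext i; simp [dil_apply]

theorem dil_dil {r s : ℝ} (hr : 0 ≤ r) (hs : 0 ≤ s) (x : Fin N → ℝ) :
    G.dil r (G.dil s x) = G.dil (r * s) x := by
  ext i; simp only [dil_apply, Real.mul_rpow hr hs, mul_assoc]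

theorem homDim_pos [NeZero N] : 0 < G.homDim :=
  Finset.sum_pos (fun i _ => G.exponent_pos i) ⟨0, Finset.mem_univ _⟩

theorem measurable_dil_uncurry : Measurable fun z : ℝ × (Fin N → ℝ) => G.dil z.1 z.2 :=
  measurable_pi_lambda _ fun i =>
    (measurable_fst.pow_const _).mul ((measurable_pi_apply i).comp measurable_snd)

theorem measurable_dil (r : ℝ) : Measurable (G.dil r) :=
  G.measurable_dil_uncurry.comp (measurable_const.prodMk measurable_id)

theorem volume_preimage_dil {r : ℝ} (hr : 0 < r) (A : Set (Fin N → ℝ)) :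
    volume (G.dil r ⁻¹' A) = ENNReal.ofReal (r ^ (-G.homDim)) * volume A := by
  classical
  have hdet : LinearMap.det (Matrix.toLin' (Matrix.diagonal fun i => r ^ G.exponent i))
      = r ^ G.homDim := by
    rw [LinearMap.det_toLin', Matrix.det_diagonal, homDim, Real.rpow_sum_of_pos hr]
  have hfun : G.dil r = Matrix.toLin' (Matrix.diagonal fun i => r ^ G.exponent i) := by
    ext x i; simp [dil_apply, Matrix.mulVec_diagonal]
  have hpos : 0 < r ^ G.homDim := Real.rpow_pos_of_pos hr _
  rw [hfun, Measure.addHaar_preimage_linearMap _ (by rw [hdet]; exact hpos.ne'), hdet,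
    abs_of_pos (inv_pos.2 hpos), Real.rpow_neg hr.le]

end HomogeneousGroup

/-! ### Quasi-balls and their volumes -/

namespace QuasiNorm

variable {N : ℕ} {G : HomogeneousGroup N} (ρ : QuasiNorm G)

theorem toFun_zero : ρ.toFun 0 = 0 := (ρ.eq_zero_iff 0).2 rfl

theorem toFun_pos {x : Fin N → ℝ} (hx : x ≠ 0) : 0 < ρ.toFun x :=
  (ρ.nonneg x).lt_of_ne fun h => hx ((ρ.eq_zero_iff x).1 h.symm)

theorem measurableSet_ball (r : ℝ) : MeasurableSet (ρ.ball r) :=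
  (isOpen_lt ρ.continuous_toFun continuous_const).measurableSet

/-- Let `c` be the minimum of the quasi-norm on the unit sphere of the sup norm. A point `x` outside
the sup-norm unit ball is carried to that sphere by some `D_r` with `r ≤ 1`. If also `|x| < 1`,
homogeneity gives `c ≤ r`, hence `|x_i| ≤ r ^ (-w_i) ≤ c ^ (-w_i)`. -/
theorem isBounded_ball_one [NeZero N] : Bornology.IsBounded (ρ.ball 1) := by
  obtain ⟨y, hy, hmin⟩ := (isCompact_sphere (0 : Fin N → ℝ) 1).exists_isMinOn
    (NormedSpace.sphere_nonempty.2 zero_le_one) ρ.continuous_toFun.continuousOn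
  have hy0 : y ≠ 0 := by rintro rfl; simp at hy
  set c := ρ.toFun y with hc
  have hcpos : 0 < c := ρ.toFun_pos hy0
  set R := 1 + ∑ j, c ^ (-G.exponent j) with hR
  have hterm : ∀ j, 0 < c ^ (-G.exponent j) := fun j => Real.rpow_pos_of_pos hcpos _
  refine (Metric.isBounded_closedBall (x := (0 : Fin N → ℝ)) (r := R)).subset fun x hx => ?_
  have hx1 : ρ.toFun x < 1 := hx
  rw [mem_closedBall_zero_iff]
  have hR1 : 1 ≤ R := by
    rw [hR]; linarith [Finset.sum_nonneg fun j (_ : j ∈ Finset.univ) => (hterm j).le]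
  rcases le_or_gt ‖x‖ 1 with h | h
  · exact h.trans hR1
  have hcont : Continuous fun r : ℝ => ‖G.dil r x‖ := by
    refine continuous_norm.comp (continuous_pi fun i => ?_)
    exact (Real.continuous_rpow_const (G.exponent_pos i).le).mul continuous_const
  have h0 : ‖G.dil 0 x‖ = 0 := by
    rw [norm_eq_zero]; ext i
    simp [HomogeneousGroup.dil_apply, Real.zero_rpow (G.exponent_pos i).ne']
  obtain ⟨r, hr, hr1⟩ := intermediate_value_Icc (zero_le_one' ℝ) hcont.continuousOn
    (show (1 : ℝ) ∈ Set.Icc ‖G.dil 0 x‖ ‖G.dil 1 x‖ by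
      rw [h0, G.dil_one]; exact ⟨zero_le_one, h.le⟩)
  simp only at hr1
  have hrpos : 0 < r := hr.1.lt_of_ne (by rintro rfl; rw [h0] at hr1; exact zero_ne_one hr1)
  have hcr : c ≤ r := by
    have h1 : c ≤ ρ.toFun (G.dil r x) := hmin (by simpa using hr1)
    rw [ρ.map_dil r x hrpos] at h1
    nlinarith
  refine (pi_norm_le_iff_of_nonneg (by linarith)).2 fun i => ?_
  have h2 : ‖G.dil r x i‖ ≤ 1 := hr1 ▸ norm_le_pi_norm _ i
  rw [HomogeneousGroup.dil_apply, norm_mul, Real.norm_of_nonneg (Real.rpow_nonneg hrpos.le _)] at h2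
  have h3 : ‖x i‖ ≤ r ^ (-G.exponent i) := by
    rw [Real.rpow_neg hrpos.le, ← one_div, le_div_iff₀ (Real.rpow_pos_of_pos hrpos _)]
    linarith
  have h4 : r ^ (-G.exponent i) ≤ c ^ (-G.exponent i) :=
    Real.rpow_le_rpow_of_nonpos hcpos hcr (by linarith [G.exponent_pos i])
  have h5 : c ^ (-G.exponent i) ≤ ∑ j, c ^ (-G.exponent j) :=
    Finset.single_le_sum (f := fun j => c ^ (-G.exponent j)) (fun j _ => (hterm j).le)
      (Finset.mem_univ i)
  linarith

theorem volume_ball_one_ne_top [NeZero N] : volume (ρ.ball 1) ≠ ∞ :=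
  ρ.isBounded_ball_one.measure_lt_top.ne

/-- The volume of the unit quasi-ball. -/
noncomputable def unitVol : ℝ := (volume : Measure (Fin N → ℝ)).real (ρ.ball 1)

theorem volume_ball_one [NeZero N] : volume (ρ.ball 1) = ENNReal.ofReal ρ.unitVol := by
  rw [unitVol, Measure.real, ENNReal.ofReal_toReal ρ.volume_ball_one_ne_top]

theorem unitVol_pos [NeZero N] : 0 < ρ.unitVol := by
  have h : 0 < volume (ρ.ball 1) :=
    (isOpen_lt ρ.continuous_toFun continuous_const).measure_pos _
      ⟨0, by simp [ρ.toFun_zero]⟩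
  exact ENNReal.toReal_pos h.ne' ρ.volume_ball_one_ne_top

theorem ball_eq_preimage {r : ℝ} (hr : 0 < r) : ρ.ball r = G.dil r⁻¹ ⁻¹' ρ.ball 1 := by
  ext x
  simp only [ball, Set.mem_ofPred_eq, Set.mem_preimage, ρ.map_dil _ x (inv_pos.2 hr)]
  rw [inv_mul_lt_iff₀ hr, mul_one]

theorem vol_eq [NeZero N] (x : Fin N → ℝ) :
    ρ.vol x = ρ.unitVol * ρ.toFun x ^ G.homDim := by
  rcases (ρ.nonneg x).eq_or_lt with h | h
  · rw [vol, ← h, Real.zero_rpow G.homDim_pos.ne', mul_zero]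
    have : ρ.ball 0 = ∅ := by ext y; simp [ball, ρ.nonneg y]
    simp [this]
  · rw [vol, Measure.real, ρ.ball_eq_preimage h, G.volume_preimage_dil (inv_pos.2 h),
      ρ.volume_ball_one, ENNReal.toReal_mul, ENNReal.toReal_ofReal ρ.unitVol_pos.le,
      ENNReal.toReal_ofReal (Real.rpow_nonneg (inv_pos.2 h).le _),
      Real.inv_rpow h.le, Real.rpow_neg h.le, inv_inv, mul_comm]

theorem vol_pos [NeZero N] {x : Fin N → ℝ} (hx : x ≠ 0) : 0 < ρ.vol x := by
  rw [vol_eq]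
  exact mul_pos ρ.unitVol_pos (Real.rpow_pos_of_pos (ρ.toFun_pos hx) _)

theorem vol_nonneg (x : Fin N → ℝ) : 0 ≤ ρ.vol x := measureReal_nonneg

theorem measurable_vol [NeZero N] : Measurable ρ.vol := by
  simp_rw [funext ρ.vol_eq]
  exact (ρ.continuous_toFun.measurable.pow_const _).const_mul _

theorem vol_lt_vol_iff [NeZero N] {x y : Fin N → ℝ} :
    ρ.vol x < ρ.vol y ↔ ρ.toFun x < ρ.toFun y := by
  rw [vol_eq, vol_eq, mul_lt_mul_iff_right₀ ρ.unitVol_pos,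
    Real.rpow_lt_rpow_iff (ρ.nonneg x) (ρ.nonneg y) G.homDim_pos]

theorem ball_eq_vol_lt [NeZero N] (x : Fin N → ℝ) :
    ρ.ball (ρ.toFun x) = ρ.vol ⁻¹' Set.Iio (ρ.vol x) := by
  ext y; simp [ball, vol_lt_vol_iff]

/-- The radius of the quasi-ball of volume `m`. -/
noncomputable def radius (m : ℝ) : ℝ := (m / ρ.unitVol) ^ (1 / G.homDim)

theorem measurable_radius : Measurable ρ.radius :=
  (measurable_id.div_const _).pow_const _

theorem radius_pos [NeZero N] {m : ℝ} (hm : 0 < m) : 0 < ρ.radius m :=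
  Real.rpow_pos_of_pos (div_pos hm ρ.unitVol_pos) _

theorem radius_vol [NeZero N] (x : Fin N → ℝ) : ρ.radius (ρ.vol x) = ρ.toFun x := by
  rw [radius, vol_eq, mul_div_cancel_left₀ _ ρ.unitVol_pos.ne', ← Real.rpow_mul (ρ.nonneg x),
    mul_one_div_cancel G.homDim_pos.ne', Real.rpow_one]

theorem unitVol_mul_radius_rpow [NeZero N] {m : ℝ} (hm : 0 ≤ m) :
    ρ.unitVol * ρ.radius m ^ G.homDim = m := by
  rw [radius, ← Real.rpow_mul (div_nonneg hm ρ.unitVol_pos.le),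
    one_div_mul_cancel G.homDim_pos.ne', Real.rpow_one, mul_div_cancel₀ _ ρ.unitVol_pos.ne']

theorem vol_lt_iff [NeZero N] {x : Fin N → ℝ} {m : ℝ} (hm : 0 < m) :
    ρ.vol x < m ↔ ρ.toFun x < ρ.radius m := by
  conv_lhs => rw [vol_eq, ← ρ.unitVol_mul_radius_rpow hm.le]
  rw [mul_lt_mul_iff_right₀ ρ.unitVol_pos,
    Real.rpow_lt_rpow_iff (ρ.nonneg x) (ρ.radius_pos hm).le G.homDim_pos]

/-! ### Polar coordinates -/

theorem toSphere_dil {r : ℝ} (hr : 0 < r) {x : Fin N → ℝ} (hx : x ≠ 0) :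
    ρ.toSphere (G.dil r x) = ρ.toSphere x := by
  have h := ρ.toFun_pos hx
  rw [toSphere, ρ.map_dil r x hr, G.dil_dil (inv_nonneg.2 (by positivity)) hr.le, toSphere]
  congr 1
  field_simp

theorem toFun_toSphere {x : Fin N → ℝ} (hx : x ≠ 0) : ρ.toFun (ρ.toSphere x) = 1 := by
  have h := ρ.toFun_pos hx
  rw [toSphere, ρ.map_dil _ x (inv_pos.2 h), inv_mul_cancel₀ h.ne']

theorem dil_toSphere {x : Fin N → ℝ} (hx : x ≠ 0) : G.dil (ρ.toFun x) (ρ.toSphere x) = x := by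
  have h := ρ.toFun_pos hx
  rw [toSphere, G.dil_dil h.le (inv_pos.2 h).le, mul_inv_cancel₀ h.ne', G.dil_one]

theorem toSphere_of_toFun_eq_one {x : Fin N → ℝ} (hx : ρ.toFun x = 1) : ρ.toSphere x = x := by
  rw [toSphere, hx, inv_one, G.dil_one]

/-- The surface measure on the unit quasi-sphere, normalised to a probability measure. -/
noncomputable def sphereProb : Measure (Fin N → ℝ) :=
  (ENNReal.ofReal ρ.unitVol)⁻¹ • ((volume.restrict (ρ.ball 1)).map ρ.toSphere)

theorem sphereProb_apply {A : Set (Fin N → ℝ)} (hA : MeasurableSet A) :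
    ρ.sphereProb A = (ENNReal.ofReal ρ.unitVol)⁻¹ * volume (ρ.toSphere ⁻¹' A ∩ ρ.ball 1) := by
  rw [sphereProb, Measure.smul_apply, Measure.map_apply ρ.measurable_toSphere hA,
    Measure.restrict_apply (ρ.measurable_toSphere hA), smul_eq_mul]

instance [NeZero N] : IsProbabilityMeasure ρ.sphereProb where
  measure_univ := by
    rw [ρ.sphereProb_apply MeasurableSet.univ, Set.preimage_univ, Set.univ_inter,
      ρ.volume_ball_one]
    exact ENNReal.inv_mul_cancel (by simpa using ρ.unitVol_pos) ENNReal.ofReal_ne_top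

theorem ae_ne_zero [NeZero N] : ∀ᵐ x : Fin N → ℝ, x ≠ 0 := by
  simp [ae_iff, measure_singleton]

theorem ae_sphereProb [NeZero N] : ∀ᵐ ω ∂ρ.sphereProb, ρ.toFun ω = 1 := by
  refine Measure.ae_smul_measure ?_ _
  have hm : MeasurableSet {ω : Fin N → ℝ | ρ.toFun ω = 1} :=
    ρ.continuous_toFun.measurable (measurableSet_singleton 1)
  rw [ae_map_iff ρ.measurable_toSphere.aemeasurable hm]
  filter_upwards [ae_restrict_of_ae (ae_ne_zero (N := N))] with x hx
  exact ρ.toFun_toSphere hx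

theorem sphereAvg_eq [NeZero N] (U : (Fin N → ℝ) → ℝ≥0∞) (x : Fin N → ℝ) :
    ρ.sphereAvg U x = ∫⁻ ω, U (G.dil (ρ.toFun x) ω) ∂ρ.sphereProb := by
  have hQ : ENNReal.ofReal G.homDim ≠ 0 := by simpa using G.homDim_pos
  rw [sphereAvg, sphereMeasure, sphereProb, lintegral_smul_measure, lintegral_smul_measure,
    Measure.smul_apply, Measure.map_apply ρ.measurable_toSphere MeasurableSet.univ,
    Set.preimage_univ, Measure.restrict_apply_univ, ρ.volume_ball_one, smul_eq_mul, smul_eq_mul,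
    smul_eq_mul, ENNReal.mul_div_mul_left _ _ hQ ENNReal.ofReal_ne_top, ENNReal.div_eq_inv_mul]

/-- Polar decomposition in terms of the volume of the quasi-ball. -/
theorem map_vol_toSphere [NeZero N] :
    (volume : Measure (Fin N → ℝ)).map (fun x => (ρ.vol x, ρ.toSphere x)) =
      ((volume : Measure ℝ).restrict (Set.Ioi 0)).prod ρ.sphereProb := by
  have hc0 : ENNReal.ofReal ρ.unitVol ≠ 0 := by simpa using ρ.unitVol_pos
  -- Up to the origin, the part of the cone over `A` of volume coordinate below `t` is a dilate of
  -- its part in the unit ball, so its measure is proportional to `t`.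
  have hIio : ∀ {A : Set (Fin N → ℝ)}, MeasurableSet A → ∀ t : ℝ,
      volume (ρ.vol ⁻¹' Set.Iio t ∩ ρ.toSphere ⁻¹' A) =
        (volume.restrict (Set.Ioi (0 : ℝ))) (Set.Iio t) * ρ.sphereProb A := by
    intro A hA t
    rw [Measure.restrict_apply measurableSet_Iio, Set.Iio_inter_Ioi, Real.volume_Ioo, sub_zero]
    rcases le_or_gt t 0 with ht | ht
    · have : ρ.vol ⁻¹' Set.Iio t = ∅ := by
        ext x; simpa using ht.trans (ρ.vol_nonneg x)
      simp [this, ENNReal.ofReal_of_nonpos ht]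
    have hr := ρ.radius_pos ht
    have hset : (ρ.vol ⁻¹' Set.Iio t ∩ ρ.toSphere ⁻¹' A : Set (Fin N → ℝ)) =ᵐ[volume]
        G.dil (ρ.radius t)⁻¹ ⁻¹' (ρ.toSphere ⁻¹' A ∩ ρ.ball 1) := by
      filter_upwards [ae_ne_zero (N := N)] with x hx
      refine propext ?_
      change (ρ.vol x < t ∧ ρ.toSphere x ∈ A) ↔
        (ρ.toSphere (G.dil (ρ.radius t)⁻¹ x) ∈ A ∧ ρ.toFun (G.dil (ρ.radius t)⁻¹ x) < 1)
      rw [ρ.toSphere_dil (inv_pos.2 hr) hx, ρ.map_dil _ _ (inv_pos.2 hr), inv_mul_lt_iff₀ hr,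
        mul_one, ρ.vol_lt_iff ht, and_comm]
    rw [measure_congr hset, G.volume_preimage_dil (inv_pos.2 hr), ρ.sphereProb_apply hA,
      ← mul_assoc]
    congr 1
    rw [Real.inv_rpow hr.le, Real.rpow_neg hr.le, inv_inv]
    conv_rhs => rw [← ρ.unitVol_mul_radius_rpow ht.le]
    rw [ENNReal.ofReal_mul ρ.unitVol_pos.le, mul_comm, ← mul_assoc,
      ENNReal.inv_mul_cancel hc0 ENNReal.ofReal_ne_top, one_mul]
  have hmeas : Measurable fun x => (ρ.vol x, ρ.toSphere x) :=
    ρ.measurable_vol.prodMk ρ.measurable_toSphere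
  refine (Measure.prod_eq fun s A hs hA => ?_).symm
  rw [Measure.map_apply hmeas (hs.prod hA)]
  -- With `A` fixed, both sides are measures on the line, finite and equal on the half-lines `Iio
  -- t`, a generating π-system.
  have key : (volume.restrict (ρ.toSphere ⁻¹' A)).map ρ.vol =
      ρ.sphereProb A • (volume : Measure ℝ).restrict (Set.Ioi 0) := by
    have hval : ∀ t : ℝ, (volume.restrict (ρ.toSphere ⁻¹' A)).map ρ.vol (Set.Iio t) =
        (ρ.sphereProb A • (volume : Measure ℝ).restrict (Set.Ioi 0)) (Set.Iio t) := by
      intro t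
      rw [Measure.map_apply ρ.measurable_vol measurableSet_Iio,
        Measure.restrict_apply (ρ.measurable_vol measurableSet_Iio), hIio hA, Measure.smul_apply,
        smul_eq_mul, mul_comm]
    refine Measure.ext_of_generateFrom_of_iUnion (Set.range Set.Iio) (fun n : ℕ => Set.Iio (n : ℝ))
      ((BorelSpace.measurable_eq (α := ℝ)).trans (borel_eq_generateFrom_Iio ℝ)) isPiSystem_Iio ?_
      (fun n => ⟨n, rfl⟩) (fun n => ?_) ?_
    · exact Set.iUnion_eq_univ_iff.2 fun x => exists_nat_gt x
    · rw [hval, Measure.smul_apply, Measure.restrict_apply measurableSet_Iio, Set.Iio_inter_Ioi]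
      exact ENNReal.mul_ne_top (measure_ne_top _ _) (by simp)
    · rintro _ ⟨t, rfl⟩
      exact hval t
  have h := congrArg (fun μ => μ s) key
  simp only [Measure.smul_apply, smul_eq_mul] at h
  rw [Measure.map_apply ρ.measurable_vol hs, Measure.restrict_apply (ρ.measurable_vol hs)] at h
  rw [mul_comm, ← h]
  rfl

theorem lintegral_polar [NeZero N] {F : (Fin N → ℝ) → ℝ≥0∞} (hF : Measurable F) :
    ∫⁻ x, F x = ∫⁻ m in Set.Ioi (0 : ℝ), ∫⁻ ω, F (G.dil (ρ.radius m) ω) ∂ρ.sphereProb := by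
  have hmeas : Measurable fun z : ℝ × (Fin N → ℝ) => F (G.dil (ρ.radius z.1) z.2) :=
    hF.comp (G.measurable_dil_uncurry.comp
      ((ρ.measurable_radius.comp measurable_fst).prodMk measurable_snd))
  rw [← lintegral_prod _ hmeas.aemeasurable, ← map_vol_toSphere,
    lintegral_map hmeas (ρ.measurable_vol.prodMk ρ.measurable_toSphere)]
  refine lintegral_congr_ae ?_
  filter_upwards [ae_ne_zero (N := N)] with x hx
  rw [ρ.radius_vol, ρ.dil_toSphere hx]

theorem map_vol [NeZero N] :
    (volume : Measure (Fin N → ℝ)).map ρ.vol = (volume : Measure ℝ).restrict (Set.Ioi 0) := by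
  have h := congrArg (Measure.map Prod.fst) ρ.map_vol_toSphere
  rwa [Measure.map_map measurable_fst (ρ.measurable_vol.prodMk ρ.measurable_toSphere),
    Measure.map_fst_prod, measure_univ, one_smul] at h

/-- Averaging a function over spheres against a radial factor. -/
theorem lintegral_mul_sphereAvg [NeZero N] {φ : ℝ → ℝ≥0∞} (hφ : Measurable φ)
    {U : (Fin N → ℝ) → ℝ≥0∞} (hU : Measurable U) :
    ∫⁻ x, φ (ρ.toFun x) * U x = ∫⁻ x, φ (ρ.toFun x) * ρ.sphereAvg U x := by
  have hU' : Measurable fun r : ℝ => ∫⁻ ω, U (G.dil r ω) ∂ρ.sphereProb :=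
    (hU.comp G.measurable_dil_uncurry).lintegral_prod_right'
  have hφ' : Measurable fun x => φ (ρ.toFun x) := hφ.comp ρ.continuous_toFun.measurable
  simp_rw [ρ.sphereAvg_eq]
  rw [ρ.lintegral_polar (F := fun x => φ (ρ.toFun x) * U x) (hφ'.mul hU), ρ.lintegral_polar (F := fun x => φ (ρ.toFun x) *
    ∫⁻ ω, U (G.dil (ρ.toFun x) ω) ∂ρ.sphereProb)
    (hφ'.mul (hU'.comp ρ.continuous_toFun.measurable))]
  refine setLIntegral_congr_fun measurableSet_Ioi fun m hm => ?_
  have hr := ρ.radius_pos hm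
  have hrho : ∀ᵐ ω ∂ρ.sphereProb, ρ.toFun (G.dil (ρ.radius m) ω) = ρ.radius m := by
    filter_upwards [ρ.ae_sphereProb] with ω hω
    rw [ρ.map_dil _ _ hr, hω, mul_one]
  have h1 : ∫⁻ ω, φ (ρ.toFun (G.dil (ρ.radius m) ω)) * U (G.dil (ρ.radius m) ω) ∂ρ.sphereProb =
      φ (ρ.radius m) * ∫⁻ ω, U (G.dil (ρ.radius m) ω) ∂ρ.sphereProb := by
    rw [← lintegral_const_mul (f := fun ω => U (G.dil (ρ.radius m) ω)) _
      (hU.comp (G.measurable_dil _))]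
    refine lintegral_congr_ae ?_
    filter_upwards [hrho] with ω hω
    rw [hω]
  have h2 : ∫⁻ ω, φ (ρ.toFun (G.dil (ρ.radius m) ω)) *
      (∫⁻ ω', U (G.dil (ρ.toFun (G.dil (ρ.radius m) ω)) ω') ∂ρ.sphereProb) ∂ρ.sphereProb =
      φ (ρ.radius m) * ∫⁻ ω, U (G.dil (ρ.radius m) ω) ∂ρ.sphereProb := by
    have : ∫⁻ _ω, φ (ρ.radius m) * (∫⁻ ω', U (G.dil (ρ.radius m) ω') ∂ρ.sphereProb)
        ∂ρ.sphereProb = φ (ρ.radius m) * ∫⁻ ω, U (G.dil (ρ.radius m) ω) ∂ρ.sphereProb := by simp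
    rw [← this]
    refine lintegral_congr_ae ?_
    filter_upwards [hrho] with ω hω
    rw [hω]
  exact h1.trans h2.symm

/-! ### Radial powers -/

theorem measurable_radialPow (t : ℝ) : Measurable (ρ.radialPow t) :=
  G.measurable_dil_uncurry.comp
    ((ρ.continuous_toFun.measurable.pow_const t).prodMk ρ.measurable_toSphere)

theorem toFun_radialPow (t : ℝ) {x : Fin N → ℝ} (hx : x ≠ 0) :
    ρ.toFun (ρ.radialPow t x) = ρ.toFun x ^ t := by
  rw [radialPow, ρ.map_dil _ _ (Real.rpow_pos_of_pos (ρ.toFun_pos hx) _), ρ.toFun_toSphere hx,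
    mul_one]

theorem toSphere_ne_zero {x : Fin N → ℝ} (hx : x ≠ 0) : ρ.toSphere x ≠ 0 := fun h => by
  have := ρ.toFun_toSphere hx
  rw [h, ρ.toFun_zero] at this
  exact zero_ne_one this

theorem radialPow_ne_zero (t : ℝ) {x : Fin N → ℝ} (hx : x ≠ 0) : ρ.radialPow t x ≠ 0 := fun h => by
  have := ρ.toFun_radialPow t hx
  rw [h, ρ.toFun_zero] at this
  exact (Real.rpow_pos_of_pos (ρ.toFun_pos hx) t).ne this

theorem radialPow_radialPow {s t : ℝ} (hst : s * t = 1) {x : Fin N → ℝ} (hx : x ≠ 0) :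
    ρ.radialPow s (ρ.radialPow t x) = x := by
  have hpos := Real.rpow_pos_of_pos (ρ.toFun_pos hx) t
  have h : ρ.toSphere (ρ.radialPow t x) = ρ.toSphere x := by
    rw [radialPow, ρ.toSphere_dil hpos (ρ.toSphere_ne_zero hx),
      ρ.toSphere_of_toFun_eq_one (ρ.toFun_toSphere hx)]
  rw [radialPow, h, ρ.toFun_radialPow t hx, ← Real.rpow_mul (ρ.nonneg x), mul_comm t, hst,
    Real.rpow_one, ρ.dil_toSphere hx]

/-- With `c` the volume of the unit ball, this is the radial power written in the volume coordinate:
`m ↦ c (m/c) ^ t` sends the radius to its `t`-th power. -/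
theorem lintegral_image_rpow {c t : ℝ} (hc : 0 < c) (ht : t ≠ 0) (Φ : ℝ → ℝ≥0∞) :
    ∫⁻ m in Set.Ioi 0, Φ m =
      ∫⁻ m in Set.Ioi 0, ENNReal.ofReal (|t| * (m / c) ^ (t - 1)) * Φ (c * (m / c) ^ t) := by
  have himage : (fun m => c * (m / c) ^ t) '' Set.Ioi 0 = Set.Ioi 0 := by
    ext y
    simp only [Set.mem_image, Set.mem_Ioi]
    constructor
    · rintro ⟨m, hm, rfl⟩
      positivity
    · intro hy
      refine ⟨c * (y / c) ^ t⁻¹, by positivity, ?_⟩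
      rw [mul_div_cancel_left₀ _ hc.ne', Real.rpow_inv_rpow (by positivity) ht]
      field_simp
  conv_lhs => rw [← himage]
  rw [lintegral_image_eq_lintegral_abs_deriv_mul (f' := fun m => t * (m / c) ^ (t - 1))
    measurableSet_Ioi (fun m hm => ?_) (fun a ha b hb hab => ?_) Φ]
  · refine setLIntegral_congr_fun measurableSet_Ioi fun m hm => ?_
    have hm' : 0 < m := hm
    simp only [abs_mul, abs_of_pos (Real.rpow_pos_of_pos (div_pos hm' hc) (t - 1))]
  · have hm' : 0 < m := hm
    have h : HasDerivAt (fun x => c * (x / c) ^ t) (c * (1 / c * t * (m / c) ^ (t - 1))) m :=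
      (((hasDerivAt_id m).div_const c).rpow_const (Or.inl (div_pos hm' hc).ne')).const_mul c
    exact (h.congr_deriv (by field_simp)).hasDerivWithinAt
  · have ha' : 0 < a := ha
    have hb' : 0 < b := hb
    have h1 : (a / c) ^ t = (b / c) ^ t := mul_left_cancel₀ hc.ne' hab
    have h2 := (Real.rpow_left_inj (by positivity) (by positivity) ht).1 h1
    exact (div_left_inj' hc.ne').1 h2

/-- Change of variables under a radial power. -/
theorem lintegral_radialPow [NeZero N] {t : ℝ} (ht : t ≠ 0) {F : (Fin N → ℝ) → ℝ≥0∞}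
    (hF : Measurable F) :
    ∫⁻ x, F x = ∫⁻ z, F (ρ.radialPow t z) *
      ENNReal.ofReal (|t| * ρ.toFun z ^ (G.homDim * (t - 1))) := by
  have hJ : Measurable fun z => ENNReal.ofReal (|t| * ρ.toFun z ^ (G.homDim * (t - 1))) :=
    ((ρ.continuous_toFun.measurable.pow_const _).const_mul _).ennreal_ofReal
  rw [ρ.lintegral_polar hF, ρ.lintegral_polar (F := fun z => F (ρ.radialPow t z) *
      ENNReal.ofReal (|t| * ρ.toFun z ^ (G.homDim * (t - 1))))
      ((hF.comp (ρ.measurable_radialPow t)).mul hJ), lintegral_image_rpow ρ.unitVol_pos ht]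
  refine setLIntegral_congr_fun measurableSet_Ioi fun m hm => ?_
  have hm' : 0 < m / ρ.unitVol := div_pos hm ρ.unitVol_pos
  have hr := ρ.radius_pos hm
  have hrad : ρ.radius (ρ.unitVol * (m / ρ.unitVol) ^ t) = ρ.radius m ^ t := by
    rw [radius, mul_div_cancel_left₀ _ ρ.unitVol_pos.ne', radius, ← Real.rpow_mul hm'.le,
      ← Real.rpow_mul hm'.le, mul_comm]
  have hjac : (m / ρ.unitVol) ^ (t - 1) = ρ.radius m ^ (G.homDim * (t - 1)) := by
    rw [radius, ← Real.rpow_mul hm'.le, ← mul_assoc, one_div_mul_cancel G.homDim_pos.ne', one_mul]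
  simp only [hrad, hjac]
  rw [← lintegral_const_mul (f := fun ω => F (G.dil (ρ.radius m ^ t) ω)) _
    (hF.comp (G.measurable_dil _))]
  refine lintegral_congr_ae ?_
  filter_upwards [ρ.ae_sphereProb] with ω hω
  have hω0 : ω ≠ 0 := by rintro rfl; rw [ρ.toFun_zero] at hω; exact zero_ne_one hω
  rw [radialPow, ρ.toSphere_dil hr hω0, ρ.toSphere_of_toFun_eq_one hω, ρ.map_dil _ _ hr, hω,
    mul_one, mul_comm]

end QuasiNorm

/-! ### Calculus of extended-real integrals -/

section ExtIntegral

variable {α : Type*} [MeasurableSpace α] {μ : Measure α}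

/-- The outer minus sign makes the case `∞ - ∞` equal to `⊤`, and multiplication by a positive real
preserves it, so scaling needs no existence assumption. -/
theorem EReal.neg_coe_sub_coe_ofReal_mul {k : ℝ} (hk : 0 < k) (a b : ℝ≥0∞) :
    -(((ENNReal.ofReal k * a : ℝ≥0∞) : EReal) - ((ENNReal.ofReal k * b : ℝ≥0∞) : EReal)) =
      (k : EReal) * -((a : EReal) - (b : EReal)) := by
  have hk' : ENNReal.ofReal k ≠ 0 := by simpa using hk
  have hcoe : ∀ x : ℝ≥0, ((ENNReal.ofReal k * x : ℝ≥0∞) : EReal) = ((k * x : ℝ) : EReal) := by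
    intro x
    rw [EReal.coe_ennreal_mul, EReal.coe_ennreal_ofReal, max_eq_left hk.le, EReal.coe_mul]
    rfl
  induction a with
  | top =>
    induction b with
    | top => simp [ENNReal.mul_top hk', EReal.coe_mul_top_of_pos hk]
    | coe b =>
      rw [hcoe, ENNReal.mul_top hk']
      change -((⊤ : EReal) - ((k * b : ℝ) : EReal)) = k * -((⊤ : EReal) - ((b : ℝ) : EReal))
      rw [EReal.top_sub_coe, EReal.top_sub_coe, EReal.neg_top, EReal.coe_mul_bot_of_pos hk]
  | coe a =>
    induction b with
    | top =>
      rw [hcoe, ENNReal.mul_top hk']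
      change -(((k * a : ℝ) : EReal) - (⊤ : EReal)) = k * -(((a : ℝ) : EReal) - (⊤ : EReal))
      simp [EReal.coe_mul_top_of_pos hk]
    | coe b =>
      rw [hcoe, hcoe]
      change -(((k * a : ℝ) : EReal) - ((k * b : ℝ) : EReal)) =
        (k : EReal) * -(((a : ℝ) : EReal) - ((b : ℝ) : EReal))
      norm_cast
      ring

theorem extIntegral_eq_top_iff {g : α → EReal} :
    extIntegral μ g = ⊤ ↔ ∫⁻ a, (g a).toENNReal ∂μ = ⊤ := by
  unfold extIntegral
  generalize ∫⁻ a, (g a).toENNReal ∂μ = P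
  generalize ∫⁻ a, (-g a).toENNReal ∂μ = M
  induction P with
  | top => simp
  | coe P =>
    induction M with
    | top =>
      change -((⊤ : EReal) - ((P : ℝ) : EReal)) = ⊤ ↔ _
      simp
    | coe M =>
      change -(((M : ℝ) : EReal) - ((P : ℝ) : EReal)) = ⊤ ↔ _
      exact iff_of_false (EReal.coe_ne_top (-((M : ℝ) - (P : ℝ)))) ENNReal.coe_ne_top

theorem extIntegral_eq_bot_iff {g : α → EReal} (h : ∫⁻ a, (g a).toENNReal ∂μ ≠ ⊤) :
    extIntegral μ g = ⊥ ↔ ∫⁻ a, (-g a).toENNReal ∂μ = ⊤ := by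
  unfold extIntegral
  generalize ∫⁻ a, (g a).toENNReal ∂μ = P at *
  generalize ∫⁻ a, (-g a).toENNReal ∂μ = M
  lift P to ℝ≥0 using h
  induction M with
  | top =>
    change -((⊤ : EReal) - ((P : ℝ) : EReal)) = ⊥ ↔ _
    simp
  | coe M =>
    change -(((M : ℝ) : EReal) - ((P : ℝ) : EReal)) = ⊥ ↔ _
    exact iff_of_false (EReal.coe_ne_bot (-((M : ℝ) - (P : ℝ)))) ENNReal.coe_ne_top

theorem extIntegral_const_mul {k : ℝ} (hk : 0 < k) {g : α → EReal} (hg : Measurable g) :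
    extIntegral μ (fun a => (k : EReal) * g a) = k * extIntegral μ g := by
  have h : ∀ x : EReal, ((k : EReal) * x).toENNReal = ENNReal.ofReal k * x.toENNReal := fun x => by
    rw [EReal.toENNReal_mul (EReal.coe_nonneg.2 hk.le), EReal.toENNReal_of_ne_top (by simp)]
    simp
  have hg' : Measurable fun a => -g a := hg.neg
  unfold extIntegral
  simp_rw [← mul_neg, h]
  rw [lintegral_const_mul _ hg.ereal_toENNReal, lintegral_const_mul _ hg'.ereal_toENNReal,
    EReal.neg_coe_sub_coe_ofReal_mul hk]

/-- Negative parts are moved across the inequality, so that all terms lie in `[0,∞]` and can be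
integrated one by one without subtraction. -/
theorem EReal.toENNReal_add_le_of_le_add {a c : EReal} {r : ℝ} (h : c ≤ a + r) :
    c.toENNReal + ((-a).toENNReal + ENNReal.ofReal (-r)) ≤
      (a.toENNReal + ENNReal.ofReal r) + (-c).toENNReal := by
  induction a with
  | top => simp
  | bot =>
    have : c = ⊥ := by simpa using h
    simp [this]
  | coe a =>
    induction c with
    | top => exact absurd (top_le_iff.1 h) (EReal.coe_ne_top (a + r))
    | bot => simp
    | coe c =>
      have h' : c ≤ a + r := by exact_mod_cast h
      rw [← EReal.coe_neg, ← EReal.coe_neg]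
      simp only [EReal.toENNReal_of_ne_top (EReal.coe_ne_top _), EReal.toReal_coe]
      have e : ∀ x : ℝ, ENNReal.ofReal x = ENNReal.ofReal (max x 0) := fun x => by simp
      rw [e c, e (-a), e (-r), e a, e r, e (-c), ← ENNReal.ofReal_add (by simp) (by simp),
        ← ENNReal.ofReal_add (by simp) (by positivity), ← ENNReal.ofReal_add (by simp) (by simp),
        ← ENNReal.ofReal_add (by positivity) (by simp)]
      refine ENNReal.ofReal_le_ofReal ?_
      have f : ∀ x : ℝ, max x 0 = x + max (-x) 0 := fun x => by
        rcases le_total x 0 with h | h <;> simp [h]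
      rw [f c, f a, f r]
      linarith

/-- If `a⁺` has infinite integral, the right side is `⊤` by convention. Otherwise `c⁺` and both
parts of `R` have finite integrals, and the integrated subtraction-free inequality can be
rearranged. -/
theorem extIntegral_le_add_integral {a c : α → EReal} {R : α → ℝ} (ha : Measurable a)
    (hc : Measurable c) (hR : Integrable R μ) (h : ∀ᵐ x ∂μ, c x ≤ a x + R x) :
    extIntegral μ c ≤ extIntegral μ a + ((∫ x, R x ∂μ : ℝ) : EReal) := by
  by_cases hatop : ∫⁻ x, (a x).toENNReal ∂μ = ⊤
  · rw [extIntegral_eq_top_iff.2 hatop, EReal.top_add_coe]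
    exact le_top
  have ha' : Measurable fun x => -a x := ha.neg
  have hc' : Measurable fun x => -c x := hc.neg
  have hkey : ∫⁻ x, (c x).toENNReal ∂μ + (∫⁻ x, (-a x).toENNReal ∂μ +
      ∫⁻ x, ENNReal.ofReal (-R x) ∂μ) ≤ (∫⁻ x, (a x).toENNReal ∂μ +
      ∫⁻ x, ENNReal.ofReal (R x) ∂μ) + ∫⁻ x, (-c x).toENNReal ∂μ := by
    rw [← lintegral_add_left ha'.ereal_toENNReal, ← lintegral_add_left hc.ereal_toENNReal,
      ← lintegral_add_left ha.ereal_toENNReal, ← lintegral_add_right _ hc'.ereal_toENNReal]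
    refine lintegral_mono_ae ?_
    filter_upwards [h] with x hx using EReal.toENNReal_add_le_of_le_add hx
  have hctop : ∫⁻ x, (c x).toENNReal ∂μ ≤ ∫⁻ x, (a x).toENNReal ∂μ +
      ∫⁻ x, ENNReal.ofReal (R x) ∂μ := by
    rw [← lintegral_add_left ha.ereal_toENNReal]
    refine lintegral_mono_ae ?_
    filter_upwards [h] with x hx
    refine (EReal.toENNReal_le_toENNReal hx).trans (EReal.toENNReal_add_le.trans ?_)
    simp
  have hRp := hR.lintegral_lt_top.ne
  have hRn := hR.neg.lintegral_lt_top.ne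
  rw [integral_eq_lintegral_pos_part_sub_lintegral_neg_part hR]
  simp only [Pi.neg_apply] at hRn
  unfold extIntegral
  generalize ∫⁻ x, (c x).toENNReal ∂μ = C at *
  generalize ∫⁻ x, (-c x).toENNReal ∂μ = C' at *
  generalize ∫⁻ x, (a x).toENNReal ∂μ = A at *
  generalize ∫⁻ x, (-a x).toENNReal ∂μ = A' at *
  generalize ∫⁻ x, ENNReal.ofReal (R x) ∂μ = P at *
  generalize ∫⁻ x, ENNReal.ofReal (-R x) ∂μ = P' at *
  have hC : C ≠ ⊤ := ne_top_of_le_ne_top (ENNReal.add_ne_top.2 ⟨hatop, hRp⟩) hctop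
  lift C to ℝ≥0 using hC
  lift A to ℝ≥0 using hatop
  lift P to ℝ≥0 using hRp
  lift P' to ℝ≥0 using hRn
  induction C' with
  | top =>
    change -((⊤ : EReal) - ((C : ℝ) : EReal)) ≤ _
    simp
  | coe C' =>
    induction A' with
    | top => exact absurd hkey (by simp [← ENNReal.coe_add])
    | coe A' =>
      have hkey' : (C : ℝ) + (A' + P') ≤ A + P + C' := by exact_mod_cast hkey
      change -(((C' : ℝ) : EReal) - ((C : ℝ) : EReal)) ≤
        -(((A' : ℝ) : EReal) - ((A : ℝ) : EReal)) + (((P : ℝ) - (P' : ℝ) : ℝ) : EReal)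
      norm_cast
      linarith

end ExtIntegral

/-! ### From complements of balls to balls -/

namespace QuasiNorm

variable {N : ℕ} {G : HomogeneousGroup N} (ρ : QuasiNorm G)

theorem volume_vol_eq [NeZero N] (m : ℝ) : volume {z : Fin N → ℝ | ρ.vol z = m} = 0 := by
  have h := congrArg (fun μ => μ {m}) ρ.map_vol
  simp only [Measure.map_apply ρ.measurable_vol (measurableSet_singleton m)] at h
  exact h.trans (by simp)

theorem measurable_tildeWeight (ε : ℝ) {w : (Fin N → ℝ) → ℝ≥0} (hw : Measurable w) :
    Measurable (ρ.tildeWeight ε w) :=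
  (hw.comp (ρ.measurable_radialPow _)).coe_nnreal_ennreal.mul
    ((ρ.continuous_toFun.measurable.pow_const _).const_mul _).ennreal_ofReal

theorem tildeWeight_ne_top (ε : ℝ) (w : (Fin N → ℝ) → ℝ≥0) (s : Fin N → ℝ) :
    ρ.tildeWeight ε w s ≠ ⊤ :=
  ENNReal.mul_ne_top ENNReal.coe_ne_top ENNReal.ofReal_ne_top

/-- The factor in the transformed weight is exactly the Jacobian of the radial power with exponent
`-1/ε`. -/
theorem lintegral_mul_weight [NeZero N] {ε : ℝ} (hε : 0 < ε) {w : (Fin N → ℝ) → ℝ≥0}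
    (hw : Measurable w) {F : (Fin N → ℝ) → ℝ≥0∞} (hF : Measurable F) :
    ∫⁻ x, F x * w x = ∫⁻ s, F (ρ.radialPow (-(1 / ε)) s) * ρ.tildeWeight ε w s := by
  rw [ρ.lintegral_radialPow (t := -(1 / ε)) (by simp [hε.ne'])
    (F := fun x => F x * w x) (hF.mul hw.coe_nnreal_ennreal)]
  refine lintegral_congr fun s => ?_
  rw [tildeWeight, mul_assoc, abs_neg, abs_of_pos (one_div_pos.2 hε), one_div]
  congr 5
  ring

/-- The negative exponent reverses the order of radii, and in the product of kernel and Jacobian the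
powers of `|z|` cancel, leaving a constant. -/
theorem setLIntegral_compl_ball [NeZero N] {ε : ℝ} (hε : 0 < ε) {L : (Fin N → ℝ) → ℝ}
    (hL : Measurable L) {s : Fin N → ℝ} (hs : s ≠ 0) :
    ∫⁻ y in (ρ.ball (ρ.toFun (ρ.radialPow (-(1 / ε)) s)))ᶜ,
        ENNReal.ofReal (ρ.vol y ^ (-ε - 1) * L y) =
      ENNReal.ofReal (ρ.unitVol ^ (-ε - 1) * ε⁻¹) *
        ∫⁻ z in ρ.ball (ρ.toFun s), ENNReal.ofReal (L (ρ.radialPow (-(1 / ε)) z)) := by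
  have hc := ρ.unitVol_pos
  have hmeas : Measurable fun y => ENNReal.ofReal (ρ.vol y ^ (-ε - 1) * L y) :=
    ((ρ.measurable_vol.pow_const _).mul hL).ennreal_ofReal
  have hmeas' : Measurable fun z => ENNReal.ofReal (L (ρ.radialPow (-(1 / ε)) z)) :=
    (hL.comp (ρ.measurable_radialPow _)).ennreal_ofReal
  rw [← lintegral_indicator (ρ.measurableSet_ball _).compl,
    ← lintegral_const_mul _ hmeas', ← lintegral_indicator (ρ.measurableSet_ball _),
    ρ.lintegral_radialPow (t := -(1 / ε)) (by simp [hε.ne'])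
      (hmeas.indicator (ρ.measurableSet_ball _).compl)]
  refine lintegral_congr_ae ?_
  -- The complement contains its bounding sphere, whereas the ball does not; that sphere is null.
  have hnull : ∀ᵐ z : Fin N → ℝ, ρ.vol z ≠ ρ.vol s := by
    simpa [ae_iff] using ρ.volume_vol_eq (ρ.vol s)
  filter_upwards [ae_ne_zero (N := N), hnull] with z hz hzs
  have hz' := ρ.toFun_pos hz
  have hs' := ρ.toFun_pos hs
  have hiff : ρ.radialPow (-(1 / ε)) z ∈ (ρ.ball (ρ.toFun (ρ.radialPow (-(1 / ε)) s)))ᶜ ↔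
      z ∈ ρ.ball (ρ.toFun s) := by
    change ¬ (ρ.toFun _ < ρ.toFun _) ↔ ρ.toFun z < ρ.toFun s
    rw [ρ.toFun_radialPow _ hz, ρ.toFun_radialPow _ hs,
      Real.rpow_lt_rpow_iff_of_neg hz' hs' (by simpa using hε), not_lt]
    refine ⟨fun h => h.lt_of_ne fun h' => hzs ?_, le_of_lt⟩
    rw [vol_eq, vol_eq, h']
  by_cases hmem : z ∈ ρ.ball (ρ.toFun s)
  · rw [Set.indicator_of_mem (hiff.2 hmem), Set.indicator_of_mem hmem]
    have hpos : 0 ≤ |-(1 / ε)| * ρ.toFun z ^ (G.homDim * (-(1 / ε) - 1)) := by positivity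
    rw [← ENNReal.ofReal_mul' hpos, ← ENNReal.ofReal_mul (by positivity)]
    congr 1
    have e1 : ρ.vol (ρ.radialPow (-(1 / ε)) z) ^ (-ε - 1) *
        ρ.toFun z ^ (G.homDim * (-(1 / ε) - 1)) = ρ.unitVol ^ (-ε - 1) := by
      rw [vol_eq, ρ.toFun_radialPow _ hz, Real.mul_rpow hc.le (by positivity),
        ← Real.rpow_mul hz'.le, ← Real.rpow_mul hz'.le, mul_assoc, ← Real.rpow_add hz']
      have : -(1 / ε) * G.homDim * (-ε - 1) + G.homDim * (-(1 / ε) - 1) = 0 := by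
        field_simp; ring
      rw [this, Real.rpow_zero, mul_one]
    rw [abs_neg, abs_of_pos (one_div_pos.2 hε), ← e1, one_div]
    ring
  · rw [Set.indicator_of_notMem (fun h => hmem (hiff.1 h)), Set.indicator_of_notMem hmem, zero_mul]

/-- The geometric mean of `g` over the quasi-ball through `s`. -/
noncomputable def expMean (g : (Fin N → ℝ) → ℝ) (s : Fin N → ℝ) : ℝ≥0∞ :=
  EReal.exp ((((ρ.vol s)⁻¹ : ℝ) : EReal) *
    extIntegral (volume.restrict (ρ.ball (ρ.toFun s))) (fun z => ((Real.log (g z) : ℝ) : EReal)))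

/-- The change of variables is applied to the positive and negative parts of `log f` separately, so
it also respects the values assigned to divergent integrals. The leftover constant times the
prefactor is `1/|B(0,|s|)|`. -/
theorem dualExpMean_radialPow [NeZero N] {ε : ℝ} (hε : 0 < ε) {f : (Fin N → ℝ) → ℝ}
    (hf : Measurable f) {s : Fin N → ℝ} (hs : s ≠ 0) :
    ρ.dualExpMean ε f (ρ.radialPow (-(1 / ε)) s) =
      ρ.expMean (fun z => f (ρ.radialPow (-(1 / ε)) z)) s := by
  have hc := ρ.unitVol_pos
  have hs' := ρ.toFun_pos hs
  have hlog : Measurable fun x => Real.log (f x) := Real.measurable_log.comp hf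
  have h1 := ρ.setLIntegral_compl_ball hε hlog hs
  have h2 := ρ.setLIntegral_compl_ball hε hlog.neg hs
  have hto : ∀ x : ℝ, ((x : ℝ) : EReal).toENNReal = ENNReal.ofReal x := fun x => by
    rw [EReal.toENNReal_of_ne_top (EReal.coe_ne_top _), EReal.toReal_coe]
  unfold dualExpMean expMean extIntegral
  simp only [← EReal.coe_neg, hto, ← mul_neg]
  rw [h1]
  simp only [Pi.neg_apply] at h2
  rw [h2, EReal.neg_coe_sub_coe_ofReal_mul (by positivity), ← mul_assoc, ← EReal.coe_mul]
  congr 3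
  rw [vol_eq, vol_eq, ρ.toFun_radialPow _ hs, Real.mul_rpow hc.le (by positivity),
    ← Real.rpow_mul hs'.le, ← Real.rpow_mul hs'.le]
  have e2 : -(1 / ε) * G.homDim * ε = -G.homDim := by field_simp
  have e3 : -ε - 1 = -(ε + 1) := by ring
  rw [e2, e3, Real.rpow_neg hs'.le, Real.rpow_neg hc.le, Real.rpow_add hc, Real.rpow_one]
  have := Real.rpow_pos_of_pos hc ε
  field_simp

/-! ### Jensen's inequality on a ball -/

theorem volume_ball_toFun [NeZero N] (s : Fin N → ℝ) :
    volume (ρ.ball (ρ.toFun s)) = ENNReal.ofReal (ρ.vol s) := by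
  have h := congrArg (fun μ => μ (Set.Iio (ρ.vol s))) ρ.map_vol
  simp only [Measure.map_apply ρ.measurable_vol measurableSet_Iio] at h
  rw [ρ.ball_eq_vol_lt, h, Measure.restrict_apply measurableSet_Iio, Set.Iio_inter_Ioi,
    Real.volume_Ioo, sub_zero]

theorem map_vol_restrict_ball [NeZero N] (s : Fin N → ℝ) :
    (volume.restrict (ρ.ball (ρ.toFun s))).map ρ.vol =
      (volume : Measure ℝ).restrict (Set.Ioo 0 (ρ.vol s)) := by
  rw [ρ.ball_eq_vol_lt, ← Measure.restrict_map ρ.measurable_vol measurableSet_Iio, ρ.map_vol,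
    Measure.restrict_restrict measurableSet_Iio, Set.Iio_inter_Ioi]

theorem integrable_log_vol [NeZero N] (s : Fin N → ℝ) :
    Integrable (fun y => Real.log (ρ.vol y)) (volume.restrict (ρ.ball (ρ.toFun s))) := by
  have h : IntegrableOn Real.log (Set.Ioo 0 (ρ.vol s)) volume :=
    ((intervalIntegrable_iff_integrableOn_Ioc_of_le (ρ.vol_nonneg s)).1
      intervalIntegral.intervalIntegrable_log').mono_set Set.Ioo_subset_Ioc_self
  rw [IntegrableOn, ← ρ.map_vol_restrict_ball s] at h
  exact h.comp_measurable ρ.measurable_vol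

theorem integral_log_vol [NeZero N] (s : Fin N → ℝ) :
    ∫ y in ρ.ball (ρ.toFun s), Real.log (ρ.vol y) =
      ρ.vol s * Real.log (ρ.vol s) - ρ.vol s := by
  rw [← integral_map (f := Real.log) ρ.measurable_vol.aemeasurable
    Real.measurable_log.aestronglyMeasurable, ρ.map_vol_restrict_ball, ← integral_Ioc_eq_integral_Ioo,
    ← intervalIntegral.integral_of_le (ρ.vol_nonneg s), integral_log]
  simp

/-- This is the tangent bound `log t ≤ t - 1` at `t = g ^ p V m / c`. Choosing `c` as a mean and
integrating gives Jensen's inequality, with a real-valued remainder even where the integral of `log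
(1/V)` is `-∞`. -/
theorem log_le_log_inv_add {p g c m : ℝ} (hg : 0 < g) (hc : 0 < c) (hm : 0 < m) {V : ℝ≥0∞}
    (hV0 : V ≠ 0) (hV : V ≠ ⊤) :
    ((p : ℝ) : EReal) * ((Real.log g : ℝ) : EReal) ≤ ENNReal.log V⁻¹ +
      (((ENNReal.ofReal (g ^ p) * V * ENNReal.ofReal m).toReal / c + Real.log c - 1 -
        Real.log m : ℝ) : EReal) := by
  have ht : 0 < V.toReal := ENNReal.toReal_pos hV0 hV
  have hgp : 0 < g ^ p := Real.rpow_pos_of_pos hg p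
  rw [ENNReal.log_inv, ENNReal.log_pos_real hV0 hV, ENNReal.toReal_mul, ENNReal.toReal_mul,
    ENNReal.toReal_ofReal hgp.le, ENNReal.toReal_ofReal hm.le]
  norm_cast
  have h := Real.log_le_sub_one_of_pos (show 0 < g ^ p * V.toReal * m / c by positivity)
  rw [Real.log_div (by positivity) hc.ne', Real.log_mul (by positivity) hm.ne',
    Real.log_mul hgp.ne' ht.ne', Real.log_rpow hg] at h
  linarith

/-- The geometric mean of `1 / V` over the quasi-ball through `s`. -/
noncomputable def expMeanInv (V : (Fin N → ℝ) → ℝ≥0∞) (s : Fin N → ℝ) : ℝ≥0∞ :=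
  EReal.exp ((((ρ.vol s)⁻¹ : ℝ) : EReal) *
    extIntegral (volume.restrict (ρ.ball (ρ.toFun s))) (fun y => ENNReal.log (V y)⁻¹))

theorem lintegral_log_inv_ne_top [NeZero N] {V : (Fin N → ℝ) → ℝ≥0∞} {s : Fin N → ℝ}
    (hs : s ≠ 0) (hE : ρ.expMeanInv V s ≠ ⊤) :
    ∫⁻ y in ρ.ball (ρ.toFun s), (ENNReal.log (V y)⁻¹).toENNReal ≠ ⊤ := fun h => by
  rw [expMeanInv, extIntegral_eq_top_iff.2 h,
    EReal.coe_mul_top_of_pos (inv_pos.2 (ρ.vol_pos hs))] at hE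
  exact hE EReal.exp_top

/-- Jensen's inequality for `g ^ p V · vol`. The extra factor `vol` contributes the `e`, since the
mean of `log vol` is `log m - 1`, and it later makes the Hardy-type integral converge. -/
theorem expMean_rpow_le [NeZero N] {p : ℝ} (hp : 0 < p) {g : (Fin N → ℝ) → ℝ}
    (hg : Measurable g) (hgpos : ∀ x, 0 < g x) {V : (Fin N → ℝ) → ℝ≥0∞} (hV : Measurable V)
    (hVtop : ∀ x, V x ≠ ⊤) (hI : ∫⁻ y, ENNReal.ofReal (g y ^ p) * V y ≠ ⊤)
    {s : Fin N → ℝ} (hs : s ≠ 0) (hE : ρ.expMeanInv V s ≠ ⊤) :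
    ρ.expMean g s ^ p ≤ ρ.expMeanInv V s * (ENNReal.ofReal (Real.exp 1 / ρ.vol s ^ 2) *
      ∫⁻ y in ρ.ball (ρ.toFun s),
        ENNReal.ofReal (g y ^ p) * V y * ENNReal.ofReal (ρ.vol y)) := by
  set m := ρ.vol s with hm_def
  have hm : 0 < m := ρ.vol_pos hs
  set μ := (volume : Measure (Fin N → ℝ)).restrict (ρ.ball (ρ.toFun s)) with hμ
  have hμuniv : μ Set.univ = ENNReal.ofReal m := by
    rw [hμ, Measure.restrict_apply_univ, ρ.volume_ball_toFun]
  have : IsFiniteMeasure μ := ⟨by rw [hμuniv]; exact ENNReal.ofReal_lt_top⟩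
  have hμ0 : μ ≠ 0 := by
    rw [← Measure.measure_univ_ne_zero, hμuniv]; simpa using hm
  have hvolm : ∀ᵐ y ∂μ, ρ.vol y < m := by
    refine (ae_restrict_mem (ρ.measurableSet_ball _)).mono fun y hy => ?_
    rwa [ρ.ball_eq_vol_lt] at hy
  have hne0 : ∀ᵐ y ∂μ, y ≠ 0 := ae_restrict_of_ae ae_ne_zero
  have hlogV : Measurable fun y => ENNReal.log (V y)⁻¹ := hV.inv.ennreal_log
  -- Finiteness of the geometric mean of `1/V` excludes zeros of `V` on a set of positive measure.
  have hV0 : ∀ᵐ y ∂μ, V y ≠ 0 := by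
    filter_upwards [ae_lt_top hlogV.ereal_toENNReal (ρ.lintegral_log_inv_ne_top hs hE)]
      with y hy h0
    simp [h0] at hy
  set h : (Fin N → ℝ) → ℝ≥0∞ :=
    fun y => ENNReal.ofReal (g y ^ p) * V y * ENNReal.ofReal (ρ.vol y) with hh
  have hhmeas : Measurable h :=
    ((hg.pow_const p).ennreal_ofReal.mul hV).mul ρ.measurable_vol.ennreal_ofReal
  set J := ∫⁻ y, h y ∂μ with hJ
  have hJtop : J ≠ ⊤ := by
    have h1 : J ≤ (∫⁻ y, ENNReal.ofReal (g y ^ p) * V y) * ENNReal.ofReal m := by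
      rw [← lintegral_mul_const' _ _ ENNReal.ofReal_ne_top]
      refine (lintegral_mono_ae ?_).trans (setLIntegral_le_lintegral _ _)
      filter_upwards [hvolm] with y hy
      exact mul_le_mul_right (ENNReal.ofReal_le_ofReal hy.le) _
    exact ne_top_of_le_ne_top (ENNReal.mul_ne_top hI ENNReal.ofReal_ne_top) h1
  have hJ0 : J ≠ 0 := fun h0 => by
    rw [hJ, lintegral_eq_zero_iff hhmeas] at h0
    have : ∀ᵐ y ∂μ, False := by
      filter_upwards [h0, hV0, hne0] with y hy hy0 hyne
      have hgp : 0 < g y ^ p := Real.rpow_pos_of_pos (hgpos y) p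
      simp [hh, hy0] at hy
      rcases hy with hy | hy
      · exact hy.not_gt hgp
      · exact hy.not_gt (ρ.vol_pos hyne)
    exact hμ0 (by simpa [ae_iff] using this)
  -- The tangent point is the mean of `h`: then `∫ h/M = m` cancels the `-1` of the tangent bound.
  set M := J.toReal / m with hM
  have hJpos : 0 < J.toReal := ENNReal.toReal_pos hJ0 hJtop
  have hMpos : 0 < M := div_pos hJpos hm
  have hHint : Integrable (fun y => (h y).toReal) μ :=
    integrable_toReal_of_lintegral_ne_top hhmeas.aemeasurable hJtop
  have hHval : ∫ y, (h y).toReal ∂μ = J.toReal :=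
    integral_toReal hhmeas.aemeasurable (ae_lt_top hhmeas hJtop)
  have hlint := ρ.integrable_log_vol s
  have hint1 : Integrable (fun y => (h y).toReal / M + Real.log M) μ :=
    (hHint.div_const M).add (integrable_const _)
  have hint2 : Integrable (fun y => (h y).toReal / M + Real.log M - 1) μ :=
    hint1.sub (integrable_const _)
  have hRint : Integrable
      (fun y => (h y).toReal / M + Real.log M - 1 - Real.log (ρ.vol y)) μ :=
    hint2.sub hlint
  have hμreal : μ.real Set.univ = m := by
    rw [Measure.real, hμuniv, ENNReal.toReal_ofReal hm.le]
  have hRval : ∫ y, ((h y).toReal / M + Real.log M - 1 - Real.log (ρ.vol y)) ∂μ =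
      m * (Real.log M - Real.log m + 1) := by
    rw [integral_sub hint2 hlint, integral_sub hint1 (integrable_const _),
      integral_add (hHint.div_const M) (integrable_const _), integral_div, hHval,
      integral_const, integral_const, hμreal, ρ.integral_log_vol s, ← hm_def, hM, smul_eq_mul,
      smul_eq_mul]
    have : J.toReal / (J.toReal / m) = m := by field_simp
    rw [this]; ring
  have hlogg : Measurable fun y => ((Real.log (g y) : ℝ) : EReal) :=
    (Real.measurable_log.comp hg).coe_real_ereal
  have hmain := extIntegral_le_add_integral (μ := μ) hlogV
    (hlogg.const_mul ((p : ℝ) : EReal)) hRint (by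
      filter_upwards [hV0, hne0] with y hy0 hyne
      exact log_le_log_inv_add (hgpos y) hMpos (ρ.vol_pos hyne) hy0 (hVtop y))
  rw [extIntegral_const_mul hp hlogg, hRval] at hmain
  have hexp : ENNReal.ofReal (Real.exp 1 / m ^ 2) * J =
      EReal.exp ((Real.log M - Real.log m + 1 : ℝ) : EReal) := by
    rw [EReal.exp_coe, Real.exp_add, Real.exp_sub, Real.exp_log hMpos, Real.exp_log hm]
    conv_lhs => rw [← ENNReal.ofReal_toReal hJtop]
    rw [← ENNReal.ofReal_mul (by positivity), hM]
    congr 1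
    field_simp
  rw [hexp, expMeanInv, ← EReal.exp_add, expMean, ← EReal.exp_mul]
  refine EReal.exp_monotone ?_
  have hm' : (0 : EReal) ≤ ((m⁻¹ : ℝ) : EReal) := EReal.coe_nonneg.2 (inv_pos.2 hm).le
  have h2 := mul_le_mul_of_nonneg_left hmain hm'
  rw [EReal.left_distrib_of_nonneg_of_ne_top hm' (EReal.coe_ne_top _), ← EReal.coe_mul,
    inv_mul_cancel_left₀ hm.ne'] at h2
  rw [mul_assoc, mul_comm _ ((p : ℝ) : EReal)]
  exact h2

/-! ### Measurability and radiality of the means -/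

theorem measurable_extIntegral_family {φ : ℝ → Measure (Fin N → ℝ)}
    (hφ : ∀ F : (Fin N → ℝ) → ℝ≥0∞, Measurable fun r => ∫⁻ y, F y ∂(φ r))
    (L : (Fin N → ℝ) → EReal) : Measurable fun r => extIntegral (φ r) L := by
  unfold extIntegral
  simp only [sub_eq_add_neg]
  exact ((hφ _).coe_ereal_ennreal.add (hφ _).coe_ereal_ennreal.neg).neg

/-- Monotonicity in the radius gives measurability for arbitrary `F`. -/
theorem measurable_setLIntegral_ball (F : (Fin N → ℝ) → ℝ≥0∞) :
    Measurable fun r => ∫⁻ y in ρ.ball r, F y := by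
  refine Monotone.measurable fun r s hrs => lintegral_mono_set fun y hy => ?_
  exact lt_of_lt_of_le hy hrs

theorem measurable_setLIntegral_compl_ball (F : (Fin N → ℝ) → ℝ≥0∞) :
    Measurable fun r => ∫⁻ y in (ρ.ball r)ᶜ, F y := by
  refine Antitone.measurable fun r s hrs => lintegral_mono_set fun y hy => ?_
  exact fun h => hy (lt_of_lt_of_le h hrs)

theorem measurable_dualExpMean [NeZero N] (ε : ℝ) (f : (Fin N → ℝ) → ℝ) :
    Measurable (ρ.dualExpMean ε f) := by
  have h := (measurable_extIntegral_family (φ := fun r => volume.restrict (ρ.ball r)ᶜ)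
    ρ.measurable_setLIntegral_compl_ball
    (fun y => ((ρ.vol y ^ (-ε - 1) * Real.log (f y) : ℝ) : EReal))).comp
      ρ.continuous_toFun.measurable
  exact (((ρ.measurable_vol.pow_const ε).const_mul ε).coe_real_ereal.mul h).ereal_exp

theorem exists_radial_expMean [NeZero N] (g : (Fin N → ℝ) → ℝ) :
    ∃ φ : ℝ → ℝ≥0∞, Measurable φ ∧ ∀ s, ρ.expMean g s = φ (ρ.toFun s) := by
  refine ⟨fun r => EReal.exp ((((ρ.unitVol * r ^ G.homDim)⁻¹ : ℝ) : EReal) *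
    extIntegral (volume.restrict (ρ.ball r)) (fun z => ((Real.log (g z) : ℝ) : EReal))), ?_,
    fun s => by rw [expMean, ρ.vol_eq]⟩
  have h := measurable_extIntegral_family (φ := fun r => volume.restrict (ρ.ball r))
    ρ.measurable_setLIntegral_ball (fun z => ((Real.log (g z) : ℝ) : EReal))
  exact ((((measurable_id.pow_const _).const_mul _).inv.coe_real_ereal).mul h).ereal_exp

end QuasiNorm

/-! ### Hölder, Hardy and the weighted inequality -/

/-- Hölder's inequality after splitting `h = h ^ (1/a') · h ^ (1/a)`. -/
theorem rpow_lintegral_mul_le {α : Type*} [MeasurableSpace α] {μ : Measure α} {a : ℝ}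
    (ha : 1 ≤ a) {h φ : α → ℝ≥0∞} (hh : Measurable h) (hφ : Measurable φ) :
    (∫⁻ x, h x * φ x ∂μ) ^ a ≤ (∫⁻ x, h x ∂μ) ^ (a - 1) * ∫⁻ x, h x * φ x ^ a ∂μ := by
  rcases ha.eq_or_lt with rfl | ha
  · simp
  have ha0 : 0 < a := by linarith
  have hconj : a.conjExponent.HolderConjugate a := (Real.HolderConjugate.conjExponent ha).symm
  have hsum : 1 / a.conjExponent + 1 / a = 1 := by simpa using hconj.inv_add_inv_eq_one
  have hb0 : 0 < a.conjExponent := hconj.pos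
  have hH := ENNReal.lintegral_mul_le_Lp_mul_Lq μ hconj
    (f := fun x => h x ^ (1 / a.conjExponent)) (g := fun x => h x ^ (1 / a) * φ x)
    (hh.pow_const _).aemeasurable ((hh.pow_const _).mul hφ).aemeasurable
  have e1 : ∀ x, h x ^ (1 / a.conjExponent) * (h x ^ (1 / a) * φ x) = h x * φ x := fun x => by
    rw [← mul_assoc, ← ENNReal.rpow_add_of_nonneg _ _ (by positivity) (by positivity), hsum,
      ENNReal.rpow_one]
  have e2 : ∀ x, (h x ^ (1 / a.conjExponent)) ^ a.conjExponent = h x := fun x => by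
    rw [← ENNReal.rpow_mul, one_div_mul_cancel hb0.ne', ENNReal.rpow_one]
  have e3 : ∀ x, (h x ^ (1 / a) * φ x) ^ a = h x * φ x ^ a := fun x => by
    rw [ENNReal.mul_rpow_of_nonneg _ _ ha0.le, ← ENNReal.rpow_mul, one_div_mul_cancel ha0.ne',
      ENNReal.rpow_one]
  simp only [Pi.mul_apply, e1, e2, e3] at hH
  refine (ENNReal.rpow_le_rpow hH ha0.le).trans_eq ?_
  rw [ENNReal.mul_rpow_of_nonneg _ _ ha0.le, ← ENNReal.rpow_mul, ← ENNReal.rpow_mul,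
    one_div_mul_cancel ha0.ne', ENNReal.rpow_one]
  congr 2
  have : 1 / a.conjExponent = 1 - 1 / a := by linarith
  rw [this, sub_mul, one_div_mul_cancel ha0.ne', one_mul]

namespace QuasiNorm

variable {N : ℕ} {G : HomogeneousGroup N} (ρ : QuasiNorm G)

theorem lintegral_vol_rpow [NeZero N] {a : ℝ} (ha : 0 < a) {y : Fin N → ℝ} (hy : y ≠ 0) :
    ∫⁻ s in {s | ρ.vol y < ρ.vol s}, ENNReal.ofReal (ρ.vol s ^ (-a - 1)) =
      ENNReal.ofReal (ρ.vol y ^ (-a) / a) := by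
  have hy' := ρ.vol_pos hy
  have hm : Measurable fun t : ℝ => ENNReal.ofReal (t ^ (-a - 1)) :=
    (measurable_id.pow_const _).ennreal_ofReal
  have hset : {s | ρ.vol y < ρ.vol s} = ρ.vol ⁻¹' Set.Ioi (ρ.vol y) := rfl
  rw [hset, ← setLIntegral_map measurableSet_Ioi hm ρ.measurable_vol, ρ.map_vol,
    Measure.restrict_restrict measurableSet_Ioi, Set.Ioi_inter_Ioi, max_eq_left hy'.le,
    ← ofReal_integral_eq_lintegral_ofReal
      (integrableOn_Ioi_rpow_of_lt (by linarith) hy')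
      ((ae_restrict_mem measurableSet_Ioi).mono fun t ht =>
        Real.rpow_nonneg (hy'.trans ht).le _), integral_Ioi_rpow_of_lt (by linarith) hy']
  congr 1
  rw [sub_add_cancel, neg_div_neg_eq]

/-- Tonelli: for fixed `y` the outer variable ranges over volumes above `vol y`, and `∫ t ^ (-a-1)
dt = vol y ^ (-a) / a` there cancels `vol y ^ a`. -/
theorem lintegral_hardy [NeZero N] {a : ℝ} (ha : 0 < a) {h : (Fin N → ℝ) → ℝ≥0∞}
    (hh : Measurable h) :
    ∫⁻ s, ENNReal.ofReal (ρ.vol s ^ (-a - 1)) *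
      (∫⁻ y in ρ.ball (ρ.toFun s), h y * ENNReal.ofReal (ρ.vol y) ^ a) =
      ENNReal.ofReal (1 / a) * ∫⁻ y, h y := by
  have hset : MeasurableSet {z : (Fin N → ℝ) × (Fin N → ℝ) | ρ.vol z.2 < ρ.vol z.1} :=
    measurableSet_lt (ρ.measurable_vol.comp measurable_snd) (ρ.measurable_vol.comp measurable_fst)
  set k : (Fin N → ℝ) × (Fin N → ℝ) → ℝ≥0∞ := Set.indicator
    {z | ρ.vol z.2 < ρ.vol z.1} (fun z => ENNReal.ofReal (ρ.vol z.1 ^ (-a - 1)) *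
      (h z.2 * ENNReal.ofReal (ρ.vol z.2) ^ a)) with hk
  have hφ : Measurable fun y => h y * ENNReal.ofReal (ρ.vol y) ^ a :=
    hh.mul (ρ.measurable_vol.ennreal_ofReal.pow_const a)
  have hψ : Measurable fun s => ENNReal.ofReal (ρ.vol s ^ (-a - 1)) :=
    (ρ.measurable_vol.pow_const _).ennreal_ofReal
  have hkm : Measurable k :=
    ((hψ.comp measurable_fst).mul (hφ.comp measurable_snd)).indicator hset
  have h1 : ∀ s, ENNReal.ofReal (ρ.vol s ^ (-a - 1)) *
      (∫⁻ y in ρ.ball (ρ.toFun s), h y * ENNReal.ofReal (ρ.vol y) ^ a) = ∫⁻ y, k (s, y) := by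
    intro s
    rw [← lintegral_const_mul _ hφ, ← lintegral_indicator (ρ.measurableSet_ball _),
      ρ.ball_eq_vol_lt]
    rfl
  simp_rw [h1]
  rw [lintegral_lintegral_swap (f := fun s y => k (s, y)) hkm.aemeasurable, ← lintegral_const_mul _ hh]
  refine lintegral_congr_ae ?_
  filter_upwards [ae_ne_zero (N := N)] with y hy
  have hy' := ρ.vol_pos hy
  have h2 : ∫⁻ s, k (s, y) = ∫⁻ s in {s | ρ.vol y < ρ.vol s},
      ENNReal.ofReal (ρ.vol s ^ (-a - 1)) * (h y * ENNReal.ofReal (ρ.vol y) ^ a) := by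
    rw [← lintegral_indicator (measurableSet_lt measurable_const ρ.measurable_vol)]
    rfl
  rw [h2, lintegral_mul_const _ hψ, ρ.lintegral_vol_rpow ha hy, ENNReal.ofReal_rpow_of_pos hy',
    mul_comm (h y), ← mul_assoc, ← ENNReal.ofReal_mul (by positivity)]
  congr 2
  rw [Real.rpow_neg hy'.le]
  have := Real.rpow_pos_of_pos hy' a
  field_simp

/-- The definition of the weight constant bounds the average of `U` times the `a`-th power of the
mean of `1/V` by `D ^ q m ^ (a-1)`, where `a = q/p`. Jensen and Hölder contribute `m ^ (-2a)`, and
the product is the Hardy kernel `m ^ (-a-1)`. -/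
theorem expMean_rpow_mul_le [NeZero N] {p q : ℝ} (hp : 0 < p) (hpq : p ≤ q)
    {g : (Fin N → ℝ) → ℝ}
    (hg : Measurable g) (hgpos : ∀ x, 0 < g x) {U V : (Fin N → ℝ) → ℝ≥0∞} (hV : Measurable V)
    (hVtop : ∀ x, V x ≠ ⊤) (hI : ∫⁻ y, ENNReal.ofReal (g y ^ p) * V y ≠ ⊤)
    (hD : ρ.weightConst p q U V ≠ ⊤) {s : Fin N → ℝ} (hs : s ≠ 0) :
    ρ.expMean g s ^ q * ρ.sphereAvg U s ≤
      (ρ.weightConst p q U V ^ q * ENNReal.ofReal (Real.exp (q / p)) *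
        (∫⁻ y, ENNReal.ofReal (g y ^ p) * V y) ^ (q / p - 1)) *
      (ENNReal.ofReal (ρ.vol s ^ (-(q / p) - 1)) *
        ∫⁻ y in ρ.ball (ρ.toFun s),
          ENNReal.ofReal (g y ^ p) * V y * ENNReal.ofReal (ρ.vol y) ^ (q / p)) := by
  have hq : 0 < q := hp.trans_le hpq
  have ha : 1 ≤ q / p := (one_le_div hp).2 hpq
  have ha0 : 0 < q / p := by positivity
  have hm := ρ.vol_pos hs
  set a := q / p with hadef
  set m := ρ.vol s with hmdef
  -- When the average of `U` vanishes, a finite weight constant says nothing about the mean of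
  -- `1/V`, because `0 · ∞ = 0`.
  rcases eq_or_ne (ρ.sphereAvg U s) 0 with hU | hU
  · rw [hU, mul_zero]; exact zero_le
  have hDs : ENNReal.ofReal (m ^ (1 / q - 1 / p)) * (ρ.sphereAvg U s) ^ (1 / q) *
      ρ.expMeanInv V s ^ (1 / p) ≤ ρ.weightConst p q U V := by
    unfold weightConst expMeanInv
    exact le_iSup₂_of_le s hs le_rfl
  set D := ρ.weightConst p q U V
  set u := ρ.sphereAvg U s
  set E := ρ.expMeanInv V s with hEdef
  have hmpow : 0 < m ^ (1 / q - 1 / p) := Real.rpow_pos_of_pos hm _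
  have hE : E ≠ ⊤ := fun h => by
    rw [h, ENNReal.top_rpow_of_pos (by positivity), ENNReal.mul_top] at hDs
    · exact hD (top_le_iff.1 hDs)
    · refine mul_ne_zero (by simpa using hmpow) fun h0 => hU ?_
      simpa [hq, hq.le, hq.not_gt] using h0
  set h : (Fin N → ℝ) → ℝ≥0∞ := fun y => ENNReal.ofReal (g y ^ p) * V y
  have hh : Measurable h := (hg.pow_const p).ennreal_ofReal.mul hV
  have h1 := ρ.expMean_rpow_le hp hg hgpos hV hVtop hI hs hE
  have h2 : ρ.expMean g s ^ q ≤ E ^ a * (ENNReal.ofReal (Real.exp a * m ^ (-2 * a)) *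
      (∫⁻ y in ρ.ball (ρ.toFun s), h y * ENNReal.ofReal (ρ.vol y)) ^ a) := by
    have h3 := ENNReal.rpow_le_rpow h1 ha0.le
    rw [← ENNReal.rpow_mul, ENNReal.mul_rpow_of_nonneg _ _ ha0.le,
      ENNReal.mul_rpow_of_nonneg _ _ ha0.le, ENNReal.ofReal_rpow_of_pos (by positivity)] at h3
    have e1 : p * a = q := by rw [hadef]; field_simp
    have e2 : (Real.exp 1 / m ^ 2) ^ a = Real.exp a * m ^ (-2 * a) := by
      rw [Real.div_rpow (by positivity) (by positivity), Real.exp_one_rpow, ← Real.rpow_natCast,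
        ← Real.rpow_mul hm.le, neg_mul, Real.rpow_neg hm.le, div_eq_mul_inv]
      norm_num
    rwa [e1, e2] at h3
  have h4 : (∫⁻ y in ρ.ball (ρ.toFun s), h y * ENNReal.ofReal (ρ.vol y)) ^ a ≤
      (∫⁻ y, h y) ^ (a - 1) *
        ∫⁻ y in ρ.ball (ρ.toFun s), h y * ENNReal.ofReal (ρ.vol y) ^ a := by
    refine (rpow_lintegral_mul_le ha hh ρ.measurable_vol.ennreal_ofReal).trans ?_
    exact mul_le_mul_left (ENNReal.rpow_le_rpow (setLIntegral_le_lintegral _ _) (by linarith)) _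
  have h5 : u * E ^ a ≤ D ^ q * ENNReal.ofReal (m ^ (a - 1)) := by
    have h6 := ENNReal.rpow_le_rpow hDs hq.le
    rw [ENNReal.mul_rpow_of_nonneg _ _ hq.le, ENNReal.mul_rpow_of_nonneg _ _ hq.le,
      ENNReal.ofReal_rpow_of_pos hmpow, ← ENNReal.rpow_mul, ← ENNReal.rpow_mul,
      ← Real.rpow_mul hm.le, one_div_mul_cancel hq.ne', ENNReal.rpow_one] at h6
    have e1 : (1 / q - 1 / p) * q = -(a - 1) := by rw [hadef]; field_simp; ring
    have e2 : 1 / p * q = a := by rw [hadef]; ring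
    rw [e1, e2] at h6
    calc u * E ^ a = ENNReal.ofReal (m ^ (-(a - 1)) * m ^ (a - 1)) * (u * E ^ a) := by
          rw [← Real.rpow_add hm, neg_add_cancel, Real.rpow_zero, ENNReal.ofReal_one, one_mul]
      _ = ENNReal.ofReal (m ^ (-(a - 1))) * u * E ^ a * ENNReal.ofReal (m ^ (a - 1)) := by
          rw [ENNReal.ofReal_mul (by positivity)]; ring
      _ ≤ _ := mul_le_mul_left h6 _
  set I := ∫⁻ y, h y
  set K := ∫⁻ y in ρ.ball (ρ.toFun s), h y * ENNReal.ofReal (ρ.vol y) ^ a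
  calc ρ.expMean g s ^ q * u
      ≤ E ^ a * (ENNReal.ofReal (Real.exp a * m ^ (-2 * a)) * (I ^ (a - 1) * K)) * u := by
        gcongr
        exact h2.trans (by gcongr)
    _ = (u * E ^ a) * (ENNReal.ofReal (Real.exp a * m ^ (-2 * a)) * (I ^ (a - 1) * K)) := by ring
    _ ≤ (D ^ q * ENNReal.ofReal (m ^ (a - 1))) *
        (ENNReal.ofReal (Real.exp a * m ^ (-2 * a)) * (I ^ (a - 1) * K)) := by gcongr
    _ = _ := by
        have e : m ^ (-a - 1) = m ^ (a - 1) * m ^ (-2 * a) := by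
          rw [← Real.rpow_add hm]; congr 1; ring
        rw [e, ENNReal.ofReal_mul (by positivity), ENNReal.ofReal_mul (by positivity)]
        ring

/-- The weighted inequality for the exponential mean over quasi-balls. -/
theorem lintegral_expMean_le [NeZero N] {p q : ℝ} (hp : 0 < p) (hpq : p ≤ q)
    {g : (Fin N → ℝ) → ℝ}
    (hg : Measurable g) (hgpos : ∀ x, 0 < g x) {U V : (Fin N → ℝ) → ℝ≥0∞} (hU : Measurable U)
    (hV : Measurable V)
    (hVtop : ∀ x, V x ≠ ⊤) (hI : ∫⁻ y, ENNReal.ofReal (g y ^ p) * V y ≠ ⊤)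
    (hD : ρ.weightConst p q U V ≠ ⊤) :
    (∫⁻ s, ρ.expMean g s ^ q * U s) ^ (1 / q) ≤
      ENNReal.ofReal ((p / q) ^ (1 / q) * Real.exp (1 / p)) * ρ.weightConst p q U V *
        (∫⁻ y, ENNReal.ofReal (g y ^ p) * V y) ^ (1 / p) := by
  have hq : 0 < q := hp.trans_le hpq
  have ha : 1 ≤ q / p := (one_le_div hp).2 hpq
  have ha0 : 0 < q / p := by positivity
  obtain ⟨φ, hφ, hφe⟩ := ρ.exists_radial_expMean g
  have hh : Measurable fun y => ENNReal.ofReal (g y ^ p) * V y :=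
    (hg.pow_const p).ennreal_ofReal.mul hV
  have h1 : ∫⁻ s, ρ.expMean g s ^ q * U s = ∫⁻ s, ρ.expMean g s ^ q * ρ.sphereAvg U s := by
    simp_rw [hφe]
    exact ρ.lintegral_mul_sphereAvg (φ := fun r => φ r ^ q) (hφ.pow_const q) hU
  have h2 : ∫⁻ s, ρ.expMean g s ^ q * U s ≤
      (ρ.weightConst p q U V ^ q * ENNReal.ofReal (Real.exp (q / p)) *
        (∫⁻ y, ENNReal.ofReal (g y ^ p) * V y) ^ (q / p - 1)) *
      (ENNReal.ofReal (1 / (q / p)) * ∫⁻ y, ENNReal.ofReal (g y ^ p) * V y) := by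
    rw [h1, ← ρ.lintegral_hardy ha0 hh, ← lintegral_const_mul']
    · refine lintegral_mono_ae ?_
      filter_upwards [ae_ne_zero (N := N)] with s hs
      exact ρ.expMean_rpow_mul_le hp hpq hg hgpos hV hVtop hI hD hs
    · exact ENNReal.mul_ne_top (ENNReal.mul_ne_top (ENNReal.rpow_ne_top_of_nonneg hq.le hD)
        ENNReal.ofReal_ne_top) (ENNReal.rpow_ne_top_of_nonneg (by linarith) hI)
  set D := ρ.weightConst p q U V
  set I := ∫⁻ y, ENNReal.ofReal (g y ^ p) * V y
  have hIpow : I ^ (q / p - 1) * I = I ^ (q / p) := by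
    conv_lhs => rw [← ENNReal.rpow_one I, ← ENNReal.rpow_mul, one_mul]
    rw [← ENNReal.rpow_add_of_nonneg _ _ (by linarith) zero_le_one, sub_add_cancel]
  refine (ENNReal.rpow_le_rpow h2 (by positivity : 0 ≤ 1 / q)).trans_eq ?_
  have e1 : (D ^ q * ENNReal.ofReal (Real.exp (q / p)) * I ^ (q / p - 1)) *
      (ENNReal.ofReal (1 / (q / p)) * I) =
      D ^ q * ENNReal.ofReal (p / q * Real.exp (q / p)) * I ^ (q / p) := by
    rw [← hIpow, ENNReal.ofReal_mul (by positivity), one_div_div]; ring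
  have hq1 : (0 : ℝ) ≤ 1 / q := by positivity
  rw [e1, ENNReal.mul_rpow_of_nonneg _ _ hq1, ENNReal.mul_rpow_of_nonneg _ _ hq1,
    ← ENNReal.rpow_mul, ← ENNReal.rpow_mul, mul_one_div_cancel hq.ne', ENNReal.rpow_one,
    ENNReal.ofReal_rpow_of_pos (by positivity), Real.mul_rpow (by positivity) (by positivity),
    ← Real.exp_mul]
  have e2 : q / p * (1 / q) = 1 / p := by field_simp
  rw [e2, mul_comm D]

/-! ### Upper bound for the optimal constant -/

/-- Positivity of `C` matters when `∫ f ^ p v = ∞`: the right side must then be `∞`, while the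
weight constant may be `0`. -/
theorem dualInequality_of_le [NeZero N] {p q ε : ℝ} (hp : 0 < p) (hpq : p ≤ q) (hε : 0 < ε)
    {u v : (Fin N → ℝ) → ℝ≥0} (hu : Measurable u) (hv : Measurable v)
    (hD : ρ.dualWeightConst p q ε u v ≠ ⊤) {C : ℝ≥0} (hC : 0 < C)
    (hDC : ENNReal.ofReal ((p / q) ^ (1 / q) * Real.exp (1 / p)) *
      ρ.dualWeightConst p q ε u v ≤ C) : ρ.DualInequality p q ε u v C := by
  intro f hf hfpos
  have hfp : Measurable fun x => ENNReal.ofReal (f x ^ p) := (hf.pow_const p).ennreal_ofReal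
  rcases eq_or_ne (∫⁻ x, ENNReal.ofReal (f x ^ p) * (v x : ℝ≥0∞)) ⊤ with hI | hI
  · rw [hI, ENNReal.top_rpow_of_pos (one_div_pos.2 hp), ENNReal.mul_top (by simpa using hC.ne')]
    exact le_top
  have hleft : ∫⁻ x, ρ.dualExpMean ε f x ^ q * (u x : ℝ≥0∞) =
      ∫⁻ s, ρ.expMean (fun z => f (ρ.radialPow (-(1 / ε)) z)) s ^ q * ρ.tildeWeight ε u s := by
    rw [ρ.lintegral_mul_weight hε hu ((ρ.measurable_dualExpMean ε f).pow_const q)]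
    refine lintegral_congr_ae ?_
    filter_upwards [ae_ne_zero (N := N)] with s hs
    rw [ρ.dualExpMean_radialPow hε hf hs]
  rw [ρ.lintegral_mul_weight hε hv hfp] at hI ⊢
  rw [hleft]
  refine (ρ.lintegral_expMean_le hp hpq (hf.comp (ρ.measurable_radialPow _))
    (fun x => hfpos _) (ρ.measurable_tildeWeight ε hu) (ρ.measurable_tildeWeight ε hv)
    (ρ.tildeWeight_ne_top ε v) hI hD).trans ?_
  exact mul_le_mul_left hDC _

theorem dualBestConst_le [NeZero N] {p q ε : ℝ} (hp : 0 < p) (hpq : p ≤ q) (hε : 0 < ε)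
    {u v : (Fin N → ℝ) → ℝ≥0} (hu : Measurable u) (hv : Measurable v)
    (hD : ρ.dualWeightConst p q ε u v ≠ ⊤) :
    ρ.dualBestConst p q ε u v ≤ ENNReal.ofReal ((p / q) ^ (1 / q) * Real.exp (1 / p)) *
      ρ.dualWeightConst p q ε u v := by
  -- The slack `δ` keeps the constant positive even if the weight constant is `0`.
  refine ENNReal.le_of_forall_pos_le_add fun δ hδ hlt => ?_
  rw [← ENNReal.coe_toNNReal hlt.ne, ← ENNReal.coe_add]
  refine iInf₂_le _ ⟨by positivity, ρ.dualInequality_of_le hp hpq hε hu hv hD (by positivity) ?_⟩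
  rw [ENNReal.coe_add, ENNReal.coe_toNNReal hlt.ne]
  exact le_self_add

/-! ### Positivity of the optimal constant -/

/-- If the weight constant is positive and finite, then `log V` has an integrable positive part
on some quasi-ball. -/
theorem exists_lintegral_log_ne_top [NeZero N] {p q : ℝ} (hp : 0 < p)
    {U V : (Fin N → ℝ) → ℝ≥0∞} (hD : ρ.weightConst p q U V ≠ ⊤)
    (hD0 : 0 < ρ.weightConst p q U V) :
    ∃ s : Fin N → ℝ, s ≠ 0 ∧
      ∫⁻ y in ρ.ball (ρ.toFun s), (ENNReal.log (V y)).toENNReal ≠ ⊤ := by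
  obtain ⟨s, hs0⟩ := lt_iSup_iff.1 hD0
  obtain ⟨hs, hpos⟩ := lt_iSup_iff.1 hs0
  have hle : ENNReal.ofReal (ρ.vol s ^ (1 / q - 1 / p)) * (ρ.sphereAvg U s) ^ (1 / q) *
      ρ.expMeanInv V s ^ (1 / p) ≤ ρ.weightConst p q U V := by
    unfold weightConst expMeanInv
    exact le_iSup₂_of_le s hs le_rfl
  change 0 < ENNReal.ofReal (ρ.vol s ^ (1 / q - 1 / p)) * (ρ.sphereAvg U s) ^ (1 / q) *
      ρ.expMeanInv V s ^ (1 / p) at hpos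
  have hE : ρ.expMeanInv V s ≠ ⊤ := fun h => by
    rw [h, ENNReal.top_rpow_of_pos (by positivity),
      ENNReal.mul_top (left_ne_zero_of_mul hpos.ne')] at hle
    exact hD (top_le_iff.1 hle)
  have hE0 : ρ.expMeanInv V s ≠ 0 := fun h => by
    rw [h, ENNReal.zero_rpow_of_pos (by positivity), mul_zero] at hpos
    exact lt_irrefl _ hpos
  refine ⟨s, hs, fun htop => hE0 ?_⟩
  rw [expMeanInv, (extIntegral_eq_bot_iff (ρ.lintegral_log_inv_ne_top hs hE)).2,
    EReal.coe_mul_bot_of_pos (inv_pos.2 (ρ.vol_pos hs)), EReal.exp_bot]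
  simpa only [ENNReal.log_inv, neg_neg] using htop

theorem expMean_pos [NeZero N] {g : (Fin N → ℝ) → ℝ} {s : Fin N → ℝ}
    (h1 : ∫⁻ z in ρ.ball (ρ.toFun s), ENNReal.ofReal (Real.log (g z)) ≠ ⊤)
    (h2 : ∫⁻ z in ρ.ball (ρ.toFun s), ENNReal.ofReal (-Real.log (g z)) ≠ ⊤) :
    0 < ρ.expMean g s := by
  have hto : ∀ x : ℝ, ((x : ℝ) : EReal).toENNReal = ENNReal.ofReal x := fun x => by
    rw [EReal.toENNReal_of_ne_top (EReal.coe_ne_top _), EReal.toReal_coe]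
  rw [expMean, EReal.zero_lt_exp_iff, bot_lt_iff_ne_bot]
  set X := extIntegral (volume.restrict (ρ.ball (ρ.toFun s)))
    (fun z => ((Real.log (g z) : ℝ) : EReal)) with hX
  have hbot : X ≠ ⊥ := by
    rw [hX, Ne, extIntegral_eq_bot_iff (by simpa only [hto] using h1)]
    simpa only [← EReal.coe_neg, hto] using h2
  have htop : X ≠ ⊤ := by
    rw [hX, Ne, extIntegral_eq_top_iff]
    simpa only [hto] using h1
  rw [← EReal.coe_toReal htop hbot]
  exact EReal.coe_ne_bot ((ρ.vol s)⁻¹ * X.toReal)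

/-- A positive function with `∫ g ^ p V < ∞` whose geometric means over the small quasi-balls are
positive. -/
theorem exists_test_function [NeZero N] {p : ℝ} (hp : 0 < p) {V : (Fin N → ℝ) → ℝ≥0∞}
    (hV : Measurable V) (hVtop : ∀ x, V x ≠ ⊤) {s : Fin N → ℝ} (hs : s ≠ 0)
    (hlog : ∫⁻ y in ρ.ball (ρ.toFun s), (ENNReal.log (V y)).toENNReal ≠ ⊤) :
    ∃ g : (Fin N → ℝ) → ℝ, Measurable g ∧ (∀ x, 0 < g x) ∧
      ∫⁻ y, ENNReal.ofReal (g y ^ p) * V y ≠ ⊤ ∧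
      ∀ z, ρ.toFun z ≤ ρ.toFun s → 0 < ρ.expMean g z := by
  classical
  have hm := ρ.vol_pos hs
  set m := ρ.vol s with hmdef
  -- An integrable majorant: `1` on the ball, so as not to affect `log g` there, and the integrable
  -- power `vol ^ (-2)` outside.
  set k : (Fin N → ℝ) → ℝ := fun z => if m < ρ.vol z then ρ.vol z ^ (-1 - 1 : ℝ) else 1 with hk
  have hset : MeasurableSet {z | m < ρ.vol z} := measurableSet_lt measurable_const ρ.measurable_vol
  have hkm : Measurable k :=
    Measurable.ite hset (ρ.measurable_vol.pow_const _) measurable_const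
  have hkpos : ∀ z, 0 < k z := fun z => by
    simp only [hk]
    split_ifs with h
    · exact Real.rpow_pos_of_pos (hm.trans h) _
    · exact one_pos
  have hmax : ∀ z, 0 < max 1 (V z).toReal := fun z => lt_max_of_lt_left one_pos
  -- Dividing by `max 1 V` instead of `V` gives `g ^ p V ≤ k` even where `V` vanishes, and on the
  -- ball `log g = -(1/p) log⁺ V`, whose integral is finite by `hlog`.
  set g : (Fin N → ℝ) → ℝ := fun z => (k z / max 1 (V z).toReal) ^ (1 / p) with hg
  have hgpos : ∀ z, 0 < g z := fun z => Real.rpow_pos_of_pos (div_pos (hkpos z) (hmax z)) _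
  refine ⟨g, (hkm.div (measurable_const.max hV.ennreal_toReal)).pow_const _, hgpos, ?_, ?_⟩
  · have hle : ∀ y, ENNReal.ofReal (g y ^ p) * V y ≤ ENNReal.ofReal (k y) := fun y => by
      have hgp : g y ^ p = k y / max 1 (V y).toReal := by
        simp only [hg]
        rw [← Real.rpow_mul (div_pos (hkpos y) (hmax y)).le, one_div_mul_cancel hp.ne',
          Real.rpow_one]
      conv_lhs => rw [← ENNReal.ofReal_toReal (hVtop y)]
      rw [hgp, ← ENNReal.ofReal_mul (div_pos (hkpos y) (hmax y)).le]
      refine ENNReal.ofReal_le_ofReal ?_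
      rw [div_mul_eq_mul_div, div_le_iff₀ (hmax y)]
      exact mul_le_mul_of_nonneg_left (le_max_right _ _) (hkpos y).le
    refine ne_top_of_le_ne_top ?_ (lintegral_mono hle)
    rw [← lintegral_add_compl _ hset]
    refine ENNReal.add_ne_top.2 ⟨?_, ?_⟩
    · have : ∫⁻ z in {z | m < ρ.vol z}, ENNReal.ofReal (k z) =
          ∫⁻ z in {z | m < ρ.vol z}, ENNReal.ofReal (ρ.vol z ^ (-1 - 1 : ℝ)) :=
        setLIntegral_congr_fun hset fun z hz => by
          have hz' : m < ρ.vol z := hz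
          simp only [hk, if_pos hz']
      rw [this, hmdef, ρ.lintegral_vol_rpow one_pos hs]
      exact ENNReal.ofReal_ne_top
    · have : ∫⁻ z in {z | m < ρ.vol z}ᶜ, ENNReal.ofReal (k z) =
          ∫⁻ _z in {z : Fin N → ℝ | m < ρ.vol z}ᶜ, 1 :=
        setLIntegral_congr_fun hset.compl fun z hz => by
          have hz' : ¬ m < ρ.vol z := hz
          simp only [hk, if_neg hz', ENNReal.ofReal_one]
      rw [this, setLIntegral_one]
      have hsub : ({z | m < ρ.vol z}ᶜ : Set (Fin N → ℝ)) ⊆ ρ.vol ⁻¹' Set.Iic m :=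
        fun z (hz : ¬ m < ρ.vol z) => not_lt.1 hz
      refine ne_top_of_le_ne_top ?_ (measure_mono hsub)
      rw [← Measure.map_apply ρ.measurable_vol measurableSet_Iic, ρ.map_vol,
        Measure.restrict_apply measurableSet_Iic, Set.Iic_inter_Ioi, Real.volume_Ioc]
      exact ENNReal.ofReal_ne_top
  · intro z hz
    have hlogg : ∀ y ∈ ρ.ball (ρ.toFun z),
        Real.log (g y) = -(1 / p * Real.log (max 1 (V y).toReal)) := fun y hy => by
      have hy' : ¬ m < ρ.vol y := by
        rw [hmdef, vol_lt_vol_iff, not_lt]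
        exact (lt_of_lt_of_le hy hz).le
      simp only [hg, hk, if_neg hy']
      rw [Real.log_rpow (div_pos one_pos (hmax y)), one_div (max _ _), Real.log_inv, mul_neg]
    have hball := ρ.measurableSet_ball (ρ.toFun z)
    refine ρ.expMean_pos ?_ ?_
    · have : ∫⁻ y in ρ.ball (ρ.toFun z), ENNReal.ofReal (Real.log (g y)) =
          ∫⁻ _y in ρ.ball (ρ.toFun z), 0 :=
        setLIntegral_congr_fun hball fun y hy => by
          have : 0 ≤ 1 / p * Real.log (max 1 (V y).toReal) :=
            mul_nonneg (by positivity) (Real.log_nonneg (le_max_left _ _))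
          simp only [hlogg y hy]
          exact ENNReal.ofReal_of_nonpos (by linarith)
      simp [this]
    · have hle : ∫⁻ y in ρ.ball (ρ.toFun z), ENNReal.ofReal (-Real.log (g y)) ≤
          ENNReal.ofReal (1 / p) *
            ∫⁻ y in ρ.ball (ρ.toFun s), (ENNReal.log (V y)).toENNReal := by
        rw [← lintegral_const_mul' _ _ ENNReal.ofReal_ne_top]
        refine (setLIntegral_mono' hball fun y hy => ?_).trans
          (lintegral_mono_set fun y hy => lt_of_lt_of_le hy hz)
        rw [hlogg y hy, neg_neg, ENNReal.ofReal_mul (by positivity)]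
        refine mul_le_mul_right ?_ _
        rcases le_total (V y).toReal 1 with h | h
        · rw [max_eq_left h, Real.log_one, ENNReal.ofReal_zero]
          exact zero_le
        · have h0 : V y ≠ 0 := fun h0 => by simp [h0] at h; linarith
          rw [max_eq_right h, ENNReal.log_pos_real h0 (hVtop y),
            EReal.toENNReal_of_ne_top (EReal.coe_ne_top _), EReal.toReal_coe]
      exact ne_top_of_le_ne_top (ENNReal.mul_ne_top ENNReal.ofReal_ne_top hlog) hle

/-- The test function is transported back by the inverse radial power. Small balls become
complements of large ones, so its conjugate mean is positive outside a ball, a set of infinite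
measure on which `u > 0` almost everywhere. -/
theorem dualBestConst_pos [NeZero N] {p q ε : ℝ} (hp : 0 < p) (hq : 0 < q) (hε : 0 < ε)
    {u v : (Fin N → ℝ) → ℝ≥0} (hu : Measurable u) (hv : Measurable v)
    (hD : ρ.dualWeightConst p q ε u v ≠ ⊤) (hupos : ∀ᵐ x, 0 < u x)
    (hD0 : 0 < ρ.dualWeightConst p q ε u v) : 0 < ρ.dualBestConst p q ε u v := by
  obtain ⟨s, hs, hlog⟩ := ρ.exists_lintegral_log_ne_top hp hD hD0
  obtain ⟨g, hgm, hgpos, hgI, hgE⟩ := ρ.exists_test_function hp (ρ.measurable_tildeWeight ε hv)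
    (ρ.tildeWeight_ne_top ε v) hs hlog
  have hinv1 : -ε * -(1 / ε) = 1 := by field_simp
  have hinv2 : -(1 / ε) * -ε = 1 := by field_simp
  set f : (Fin N → ℝ) → ℝ := fun x => g (ρ.radialPow (-ε) x) with hf
  have hfm : Measurable f := hgm.comp (ρ.measurable_radialPow _)
  have hfg : ∀ z, z ≠ 0 → f (ρ.radialPow (-(1 / ε)) z) = g z := fun z hz => by
    simp only [hf, ρ.radialPow_radialPow hinv1 hz]
  have hR : ∫⁻ x, ENNReal.ofReal (f x ^ p) * (v x : ℝ≥0∞) ≠ ⊤ := by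
    rw [ρ.lintegral_mul_weight hε hv (hfm.pow_const p).ennreal_ofReal]
    convert hgI using 1
    refine lintegral_congr_ae ?_
    filter_upwards [ae_ne_zero (N := N)] with z hz
    rw [hfg z hz]
  have hpos : ∀ x, ρ.vol (ρ.radialPow (-(1 / ε)) s) < ρ.vol x → 0 < ρ.dualExpMean ε f x := by
    intro x hx
    have hx0 : x ≠ 0 := by
      rintro rfl
      exact (ρ.vol_pos (ρ.radialPow_ne_zero _ hs)).not_gt
        (hx.trans_eq (by rw [ρ.vol_eq, ρ.toFun_zero, Real.zero_rpow G.homDim_pos.ne', mul_zero]))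
    set z := ρ.radialPow (-ε) x with hz
    have hz0 : z ≠ 0 := ρ.radialPow_ne_zero _ hx0
    have hxz : ρ.radialPow (-(1 / ε)) z = x := ρ.radialPow_radialPow hinv2 hx0
    have hle : ρ.toFun z ≤ ρ.toFun s := by
      rw [← hxz, vol_lt_vol_iff, ρ.toFun_radialPow _ hs, ρ.toFun_radialPow _ hz0,
        Real.rpow_lt_rpow_iff_of_neg (ρ.toFun_pos hs) (ρ.toFun_pos hz0) (by simpa using hε)] at hx
      exact hx.le
    have hmean : ρ.expMean (fun y => f (ρ.radialPow (-(1 / ε)) y)) z = ρ.expMean g z := by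
      have hae : ∀ᵐ y ∂volume.restrict (ρ.ball (ρ.toFun z)),
          f (ρ.radialPow (-(1 / ε)) y) = g y :=
        ae_restrict_of_ae (ae_ne_zero.mono hfg)
      unfold expMean extIntegral
      congr 5 <;>
      · refine lintegral_congr_ae ?_
        filter_upwards [hae] with y hy
        rw [hy]
    rw [← hxz, ρ.dualExpMean_radialPow hε hfm hz0, hmean]
    exact hgE z hle
  have hL : ∫⁻ x, ρ.dualExpMean ε f x ^ q * (u x : ℝ≥0∞) ≠ 0 := fun h0 => by
    rw [lintegral_eq_zero_iff (f := fun x => ρ.dualExpMean ε f x ^ q * (u x : ℝ≥0∞))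
      (((ρ.measurable_dualExpMean ε f).pow_const q).mul hu.coe_nnreal_ennreal)] at h0
    set m := ρ.vol (ρ.radialPow (-(1 / ε)) s)
    have hnull : ∀ᵐ x : Fin N → ℝ, ¬ m < ρ.vol x := by
      filter_upwards [h0, hupos] with x hx hux hlt
      have h1 := hpos x hlt
      rcases mul_eq_zero.1 hx with h | h
      · exact h1.ne' ((ENNReal.rpow_eq_zero_iff_of_pos hq).1 h)
      · exact hux.ne' (by simpa using h)
    have hvol : volume (ρ.vol ⁻¹' Set.Ioi m) = 0 := by
      simp only [ae_iff, not_not] at hnull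
      exact hnull
    rw [← Measure.map_apply ρ.measurable_vol measurableSet_Ioi, ρ.map_vol,
      Measure.restrict_apply measurableSet_Ioi, Set.Ioi_inter_Ioi, Real.volume_Ioi] at hvol
    exact ENNReal.top_ne_zero hvol
  -- This quotient does not depend on `C` and bounds every admissible constant from below; it is
  -- positive even if the left integral is infinite.
  have hlow : 0 < (∫⁻ x, ρ.dualExpMean ε f x ^ q * (u x : ℝ≥0∞)) ^ (1 / q) /
      (∫⁻ x, ENNReal.ofReal (f x ^ p) * (v x : ℝ≥0∞)) ^ (1 / p) :=
    ENNReal.div_pos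
      (fun h => hL ((ENNReal.rpow_eq_zero_iff_of_pos (one_div_pos.2 hq)).1 h))
      (ENNReal.rpow_ne_top_of_nonneg (one_div_pos.2 hp).le hR)
  refine hlow.trans_le (le_iInf₂ fun C hC => ?_)
  exact ENNReal.div_le_of_le_mul (hC.2 f hfm fun x => hgpos _)

end QuasiNorm

theorem theorem3p3 {N : ℕ} (hN : 0 < N) (G : HomogeneousGroup N) (ρ : QuasiNorm G)
    (p q ε : ℝ) (hp : 0 < p) (hpq : p ≤ q) (hε : 0 < ε)
    (u v : (Fin N → ℝ) → ℝ≥0) (hu : Measurable u) (hv : Measurable v)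
    (hD : ρ.dualWeightConst p q ε u v < ⊤) :
    (∃ C : ℝ≥0, 0 < C ∧ ρ.DualInequality p q ε u v C) ∧
      ρ.dualBestConst p q ε u v ≤
        ENNReal.ofReal ((p / q) ^ (1 / q) * Real.exp (1 / p)) * ρ.dualWeightConst p q ε u v ∧
      ((∀ᵐ x, 0 < u x) → 0 < ρ.dualWeightConst p q ε u v →
        0 < ρ.dualBestConst p q ε u v) := by
  have : NeZero N := ⟨hN.ne'⟩
  have htop : ENNReal.ofReal ((p / q) ^ (1 / q) * Real.exp (1 / p)) *
      ρ.dualWeightConst p q ε u v ≠ ⊤ := ENNReal.mul_ne_top ENNReal.ofReal_ne_top hD.ne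
  -- Adding `1` makes the constant positive when the weight constant is `0`.
  refine ⟨⟨_ + 1, by positivity, ρ.dualInequality_of_le hp hpq hε hu hv hD.ne
    (C := (ENNReal.ofReal ((p / q) ^ (1 / q) * Real.exp (1 / p)) *
      ρ.dualWeightConst p q ε u v).toNNReal + 1) (by positivity) ?_⟩,
    ρ.dualBestConst_le hp hpq hε hu hv hD.ne,
    ρ.dualBestConst_pos hp (hp.trans_le hpq) hε hu hv hD.ne⟩
  rw [ENNReal.coe_add, ENNReal.coe_toNNReal htop]
  exact le_self_add
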